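/- Let $M>0$ and $\sigma\in\mathbb R$, let $r(x)\in(2M,\infty)$ be the inverse of the tortoise coordinate $x=r+2M\log\big(\frac{r}{2M}-1\big)$, $x\in\mathbb R$, and for $\ell\in\mathbb N$ let $$V_{\ell,\sigma}(x)=\Big(1-\frac{2M}{r(x)}\Big)\Big(\frac{\ell(\ell+1)}{r(x)^2}+\frac{2M\sigma}{r(x)^3}\Big)$$ be the Regge–Wheeler potential. Suppose that $V_{\ell,\sigma}$ attains its maximum at $x_{\max}$, with a positive maximal value, and define $\hbar>0$ by $\hbar^2V_{\ell,\sigma}(x_{\max})=1$ (so that $\hbar\to0$ as $\ell\to\infty$). Put $V(x)=\hbar^2V_{\ell,\sigma}(x+x_{\max})$, so that $V$ has its maximum, with value $1$, at $x=0$. In $L^2(\mathbb R)$ let $p=-i\hbar\partial_x$, $H=p^2+V$ and $A=\frac12(px+xp)$; here $H$ and the commutator $\frac{i}{\hbar}[H,A]$ are understood as the closures of the corresponding operators on $C_c^\infty(\mathbb R)$. **Lemma (Mourre estimate up to and including the trapping top energy).** For every $\varepsilon>0$ there are $\hbar_0>0$ and $c_0>0$, depending only on $M$, $\sigma$, $\varepsilon$,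 such that for all $\ell$ for which $\hbar\le\hbar_0$ the following holds. The operator $H$ is self-adjoint and, with $\chi_I(H)$ the spectral projection of $H$ associated with $I=[\varepsilon/2,100]$, the range of $\chi_I(H)$ is contained in the domain of $\frac{i}{\hbar}[H,A]$ and $$\chi_I(H)\,\frac{i}{\hbar}[H,A]\,\chi_I(H)\ \ge\ c_0\,\hbar\,\chi_I(H)$$ in the sense of quadratic forms on $L^2(\mathbb R)$. -/

import Mathlib

open MeasureTheory Set
open scoped ContDiff ComplexOrder

noncomputable section

namespace ReggeWheeler

/-! ### The Regge–Wheeler potential in the tortoise coordinate -/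

/-- The tortoise coordinate `x = r + 2M log (r / (2M) - 1)`, used for `r > 2M`. -/
def tortoise (M r : ℝ) : ℝ := r + 2 * M * Real.log (r / (2 * M) - 1)

/-- The area radius `r(x)`: the inverse of the tortoise coordinate on `(2M, ∞)`. -/
def radius (M x : ℝ) : ℝ := Function.invFunOn (tortoise M) (Ioi (2 * M)) x

/-- The Regge–Wheeler potential
`V_{ℓ,σ}(x) = (1 - 2M/r(x)) (ℓ(ℓ+1)/r(x)² + 2Mσ/r(x)³)`. -/
def potential (M σ : ℝ) (ℓ : ℕ) (x : ℝ) : ℝ :=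
  (1 - 2 * M / radius M x) *
    ((ℓ : ℝ) * (ℓ + 1) / radius M x ^ 2 + 2 * M * σ / radius M x ^ 3)

lemma sub_pos_of_mem {M r : ℝ} (hM : 0 < M) (hr : r ∈ Ioi (2 * M)) : 0 < r / (2 * M) - 1 := by
  have h : (0 : ℝ) < 2 * M := by positivity
  have : 1 < r / (2 * M) := by rw [one_lt_div h]; exact hr
  linarith

lemma tortoise_strictMonoOn {M : ℝ} (hM : 0 < M) : StrictMonoOn (tortoise M) (Ioi (2 * M)) := by
  intro a ha b hb hab
  have h : (0 : ℝ) < 2 * M := by positivity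
  have h1 : a / (2 * M) - 1 < b / (2 * M) - 1 := by
    have := div_lt_div_of_pos_right hab h
    linarith
  have h2 := Real.log_lt_log (sub_pos_of_mem hM ha) h1
  have h3 := mul_lt_mul_of_pos_left h2 h
  unfold tortoise
  linarith

lemma tortoise_contDiffAt {M r : ℝ} (hM : 0 < M) (hr : r ∈ Ioi (2 * M)) :
    ContDiffAt ℝ ∞ (tortoise M) r := by
  have h := (sub_pos_of_mem hM hr).ne'
  unfold tortoise
  exact contDiffAt_id.add (contDiffAt_const.mul
    (((contDiffAt_id.div_const _).sub contDiffAt_const).log h))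

lemma tortoise_hasDerivAt {M r : ℝ} (hM : 0 < M) (hr : r ∈ Ioi (2 * M)) :
    HasDerivAt (tortoise M) (1 + 2 * M * (1 / (2 * M) / (r / (2 * M) - 1))) r := by
  have h := (sub_pos_of_mem hM hr).ne'
  unfold tortoise
  exact (hasDerivAt_id r).add
    (((((hasDerivAt_id r).div_const (2 * M)).sub_const 1).log h).const_mul (2 * M))

lemma tortoise_surjOn {M : ℝ} (hM : 0 < M) : SurjOn (tortoise M) (Ioi (2 * M)) univ := by
  intro y _
  have h : (0 : ℝ) < 2 * M := by positivity
  have key : ∀ t : ℝ, 2 * M * (1 + Real.exp t) ∈ Ioi (2 * M) ∧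
      tortoise M (2 * M * (1 + Real.exp t)) = 2 * M + 2 * M * Real.exp t + 2 * M * t := by
    intro t
    refine ⟨?_, ?_⟩
    · have := mul_pos h (Real.exp_pos t)
      simp only [mem_Ioi]
      linarith
    · have e : 2 * M * (1 + Real.exp t) / (2 * M) - 1 = Real.exp t := by
        field_simp
        ring
      unfold tortoise
      rw [e, Real.log_exp]
      ring
  have hcont : ContinuousOn (tortoise M) (Ioi (2 * M)) := fun r hr =>
    (tortoise_contDiffAt hM hr).continuousAt.continuousWithinAt
  obtain ⟨ha, ea⟩ := key (-(|y| / (2 * M) + 2))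
  obtain ⟨hb, eb⟩ := key (|y| / (2 * M))
  refine isPreconnected_Ioi.intermediate_value ha hb hcont ⟨?_, ?_⟩
  · rw [ea]
    have h1 : Real.exp (-(|y| / (2 * M) + 2)) ≤ 1 := Real.exp_le_one_iff.mpr (by
      have : 0 ≤ |y| / (2 * M) := by positivity
      linarith)
    have h2 := mul_le_mul_of_nonneg_left h1 h.le
    have h3 : 2 * M * -(|y| / (2 * M) + 2) = -|y| - 4 * M := by
      field_simp
      ring
    rw [h3]
    have := neg_abs_le y
    linarith
  · rw [eb]
    have h2 := mul_pos h (Real.exp_pos (|y| / (2 * M)))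
    have h3 : 2 * M * (|y| / (2 * M)) = |y| := by field_simp
    rw [h3]
    have := le_abs_self y
    linarith

lemma radius_mem {M : ℝ} (hM : 0 < M) (x : ℝ) : radius M x ∈ Ioi (2 * M) :=
  Function.invFunOn_mem (tortoise_surjOn hM (mem_univ x))

lemma tortoise_radius {M : ℝ} (hM : 0 < M) (x : ℝ) : tortoise M (radius M x) = x :=
  Function.invFunOn_eq (tortoise_surjOn hM (mem_univ x))

lemma radius_contDiff {M : ℝ} (hM : 0 < M) : ContDiff ℝ ∞ (radius M) := by
  rw [contDiff_iff_contDiffAt]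
  intro x
  have hr := radius_mem hM x
  have hcd := tortoise_contDiffAt hM hr
  have hd := tortoise_hasDerivAt hM hr
  have hpos := sub_pos_of_mem hM hr
  have hne : 1 + 2 * M * (1 / (2 * M) / (radius M x / (2 * M) - 1)) ≠ 0 := by positivity
  have hd' : HasFDerivAt (tortoise M)
      ((ContinuousLinearEquiv.unitsEquivAut ℝ (Units.mk0 _ hne) : ℝ ≃L[ℝ] ℝ) : ℝ →L[ℝ] ℝ)
      (radius M x) := by
    have e : ((ContinuousLinearEquiv.unitsEquivAut ℝ (Units.mk0 _ hne) : ℝ ≃L[ℝ] ℝ) : ℝ →L[ℝ] ℝ)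
        = ContinuousLinearMap.toSpanSingleton ℝ
          (1 + 2 * M * (1 / (2 * M) / (radius M x / (2 * M) - 1))) := by
      ext
      simp
    rw [e]
    exact hd.hasFDerivAt
  have hn : (∞ : WithTop ℕ∞) ≠ 0 := by simp
  have h1 := hcd.to_localInverse hd' hn
  have himg := hcd.localInverse_apply_image hd' hn
  rw [tortoise_radius hM] at h1 himg
  refine h1.congr_of_eventuallyEq ?_
  have hev : ∀ᶠ y in nhds x, tortoise M (hcd.localInverse hd' hn y) = y := by
    have := (hcd.hasStrictFDerivAt' hd' hn).eventually_right_inverse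
    rw [tortoise_radius hM] at this
    exact this
  have hmem : ∀ᶠ y in nhds x, hcd.localInverse hd' hn y ∈ Ioi (2 * M) :=
    h1.continuousAt.eventually_mem (by rw [himg]; exact isOpen_Ioi.mem_nhds hr)
  filter_upwards [hev, hmem] with y hy1 hy2
  exact (tortoise_strictMonoOn hM).injOn (radius_mem hM y) hy2
    ((tortoise_radius hM y).trans hy1.symm)

lemma potential_contDiff {M : ℝ} (hM : 0 < M) (σ : ℝ) (ℓ : ℕ) :
    ContDiff ℝ ∞ (potential M σ ℓ) := by
  have h : ∀ x, radius M x ≠ 0 := fun x => by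
    have h1 : 2 * M < radius M x := radius_mem hM x
    have : 0 < radius M x := by linarith
    exact this.ne'
  have hr := radius_contDiff hM
  unfold potential
  exact (contDiff_const.sub (contDiff_const.div hr h)).mul
    ((contDiff_const.div (hr.pow 2) fun x => pow_ne_zero 2 (h x)).add
      (contDiff_const.div (hr.pow 3) fun x => pow_ne_zero 3 (h x)))

/-- The semiclassical potential `V(x; ħ) = ħ² V_{ℓ,σ}`, translated so that the point `xmax` is
moved to the origin. -/
def semiPotential (M σ : ℝ) (ℓ : ℕ) (hbar xmax x : ℝ) : ℝ :=
  hbar ^ 2 * potential M σ ℓ (x + xmax)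

lemma semiPotential_contDiff {M : ℝ} (hM : 0 < M) (σ : ℝ) (ℓ : ℕ) (hbar xmax : ℝ) :
    ContDiff ℝ ∞ (semiPotential M σ ℓ hbar xmax) :=
  contDiff_const.mul ((potential_contDiff hM σ ℓ).comp (contDiff_id.add contDiff_const))

end ReggeWheeler

namespace Semiclassical

/-! ### Differential operators on test functions -/

/-- The space `C_c^∞(ℝ; ℂ)`. -/
def TestFn : Submodule ℂ (ℝ → ℂ) where
  carrier := {φ | ContDiff ℝ ∞ φ ∧ HasCompactSupport φ}
  zero_mem' := ⟨contDiff_const, HasCompactSupport.zero⟩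
  add_mem' h₁ h₂ := ⟨h₁.1.add h₂.1, h₁.2.add h₂.2⟩
  smul_mem' c _ h := ⟨contDiff_const.smul h.1, h.2.smul_left (f := fun _ => c)⟩

/-- The momentum operator `p = -iħ d/dx` on test functions. -/
def p (hbar : ℝ) : Module.End ℂ TestFn where
  toFun φ := ⟨fun x => -Complex.I * hbar * deriv φ.1 x,
    contDiff_const.mul ((contDiff_infty_iff_deriv.1 φ.2.1).2),
    HasCompactSupport.mul_left (f := fun _ => -Complex.I * (hbar : ℂ)) φ.2.2.deriv⟩
  map_add' φ ψ := by
    ext x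
    have h₁ : DifferentiableAt ℝ φ.1 x := (contDiff_infty_iff_deriv.1 φ.2.1).1 x
    have h₂ : DifferentiableAt ℝ ψ.1 x := (contDiff_infty_iff_deriv.1 ψ.2.1).1 x
    simp [deriv_add h₁ h₂, mul_add]
  map_smul' c φ := by
    ext x
    have h₁ : DifferentiableAt ℝ φ.1 x := (contDiff_infty_iff_deriv.1 φ.2.1).1 x
    simp [deriv_const_smul c h₁]
    ring

/-- Multiplication by a smooth real function on test functions. -/
def mulOp (v : ℝ → ℝ) (hv : ContDiff ℝ ∞ v) : Module.End ℂ TestFn where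
  toFun φ := ⟨fun x => (v x : ℂ) * φ.1 x,
    (Complex.ofRealCLM.contDiff.comp hv).mul φ.2.1,
    HasCompactSupport.mul_left (f := fun x => (v x : ℂ)) φ.2.2⟩
  map_add' φ ψ := by
    ext x
    simp [mul_add]
  map_smul' c φ := by
    ext x
    simp
    ring

/-- The position operator `x` on test functions. -/
def pos : Module.End ℂ TestFn := mulOp (fun x => x) contDiff_id

/-- The Schrödinger operator `p² + V` on test functions. -/
def schrodinger (hbar : ℝ) (v : ℝ → ℝ) (hv : ContDiff ℝ ∞ v) : Module.End ℂ TestFn :=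
  p hbar ^ 2 + mulOp v hv

/-- The generator of dilations `A = (p x + x p) / 2` on test functions. -/
def dilation (hbar : ℝ) : Module.End ℂ TestFn :=
  (1 / 2 : ℂ) • (p hbar * pos + pos * p hbar)

/-- The commutator `(i/ħ) [S, T] = (i/ħ) (S T - T S)` on test functions. -/
def scaledCommutator (hbar : ℝ) (S T : Module.End ℂ TestFn) : Module.End ℂ TestFn :=
  (Complex.I / hbar) • (S * T - T * S)

/-! ### Operators in `L²(ℝ)` -/

/-- The Hilbert space `L²(ℝ; ℂ)`. -/
abbrev L2 : Type := Lp ℂ 2 (volume : Measure ℝ)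

lemma testFn_memLp (φ : TestFn) : MemLp φ.1 2 (volume : Measure ℝ) :=
  φ.2.1.continuous.memLp_of_hasCompactSupport φ.2.2

/-- The inclusion `C_c^∞(ℝ; ℂ) → L²(ℝ; ℂ)`. -/
def toL2 : TestFn →ₗ[ℂ] L2 where
  toFun φ := (testFn_memLp φ).toLp φ.1
  map_add' φ ψ := MemLp.toLp_add (testFn_memLp φ) (testFn_memLp ψ)
  map_smul' c φ := MemLp.toLp_const_smul c (testFn_memLp φ)

lemma toL2_injective : Function.Injective toL2 := by
  intro φ ψ h
  have h1 : φ.1 =ᵐ[volume] ψ.1 := (MemLp.toLp_eq_toLp_iff (testFn_memLp φ) (testFn_memLp ψ)).1 h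
  exact Subtype.ext
    ((φ.2.1.continuous.ae_eq_iff_eq volume ψ.2.1.continuous).1 h1)

/-- An operator on test functions, viewed as an unbounded operator in `L²(ℝ)` with domain
`C_c^∞(ℝ)`. -/
def onTestFn (T : Module.End ℂ TestFn) : L2 →ₗ.[ℂ] L2 where
  domain := LinearMap.range toL2
  toFun := (toL2 ∘ₗ T) ∘ₗ (LinearEquiv.ofInjective toL2 toL2_injective).symm.toLinearMap

/-- The closed realization in `L²(ℝ)` of an operator given on test functions. -/
def realization (T : Module.End ℂ TestFn) : L2 →ₗ.[ℂ] L2 := (onTestFn T).closure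

/-! ### Spectral measures and spectral projections -/

variable {𝓗 : Type*} [NormedAddCommGroup 𝓗] [InnerProductSpace ℂ 𝓗] [CompleteSpace 𝓗]

/-- `E` is the (projection-valued) spectral measure of the unbounded operator `T`:
its values are orthogonal projections, `E ℝ = 1`, `E (B ∩ C) = E B E C`, for every vector `ψ` the
function `B ↦ ⟪ψ, E B ψ⟫` is a (countably additive) measure `μ` on the Borel sets,
and `T = ∫ t dE(t)`, i.e. `ψ` is in the domain of `T` iff `∫ t² dμ < ∞`, and then
`⟪ψ, T ψ⟫ = ∫ t dμ`. (By polarization this last identity determines `T` on its domain.) -/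
structure IsSpectralMeasure (T : 𝓗 →ₗ.[ℂ] 𝓗) (E : Set ℝ → 𝓗 →L[ℂ] 𝓗) : Prop where
  isStarProjection : ∀ B, MeasurableSet B → IsStarProjection (E B)
  apply_univ : E univ = 1
  apply_inter : ∀ B C, MeasurableSet B → MeasurableSet C → E (B ∩ C) = E B * E C
  exists_measure : ∀ ψ : 𝓗, ∃ μ : Measure ℝ, IsFiniteMeasure μ ∧
    (∀ B, MeasurableSet B → ((μ.real B : ℝ) : ℂ) = inner ℂ ψ (E B ψ)) ∧
    (ψ ∈ T.domain ↔ Integrable (fun t : ℝ => t ^ 2) μ) ∧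
    ∀ h : ψ ∈ T.domain, inner ℂ ψ (T ⟨ψ, h⟩) = ((∫ t, t ∂μ : ℝ) : ℂ)

open Classical in
/-- The spectral projection `χ_B(T)`: the value at `B` of the spectral measure of `T`, which by the
spectral theorem exists (and is unique) for every self-adjoint `T`. -/
def spectralProjection (T : 𝓗 →ₗ.[ℂ] 𝓗) (B : Set ℝ) : 𝓗 →L[ℂ] 𝓗 :=
  if h : ∃ E, IsSpectralMeasure T E then h.choose B else 0

end Semiclassical

namespace ReggeWheeler

open Semiclassical

variable {M : ℝ} (hM : 0 < M) (σ : ℝ) (ℓ : ℕ) (hbar xmax : ℝ)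

/-- `p² + V` with the translated semiclassical Regge–Wheeler potential, on test functions. -/
def hamiltonianCore : Module.End ℂ TestFn :=
  schrodinger hbar (semiPotential M σ ℓ hbar xmax) (semiPotential_contDiff hM σ ℓ hbar xmax)

/-- The semiclassical Regge–Wheeler operator `H = p² + V` in `L²(ℝ)`: the closure of `p² + V` on
`C_c^∞(ℝ)`. -/
def hamiltonian : L2 →ₗ.[ℂ] L2 := realization (hamiltonianCore hM σ ℓ hbar xmax)

/-- The operator `(i/ħ) [H, A]` in `L²(ℝ)`: the closure of the commutator computed on
`C_c^∞(ℝ)`. -/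
def commutatorHA : L2 →ₗ.[ℂ] L2 :=
  realization (scaledCommutator hbar (hamiltonianCore hM σ ℓ hbar xmax) (dilation hbar))

/-- The spectral projection `χ_I(H)`. -/
def energyProjection (I : Set ℝ) : L2 →L[ℂ] L2 :=
  spectralProjection (hamiltonian hM σ ℓ hbar xmax) I

end ReggeWheeler

end

noncomputable section

/-! ### Closures of symmetric operators -/

namespace LinearPMap

open Filter Topology

variable {𝓗 : Type*} [NormedAddCommGroup 𝓗] [InnerProductSpace ℂ 𝓗]
variable {T : 𝓗 →ₗ.[ℂ] 𝓗}

/-! On test functions the commutator is `2p² + W` with `W = -xV'`. Since `V` has a single critical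
point, at `x = 0`, one has `W ≥ 0`, but `W` vanishes at the top of the barrier, so `W` alone cannot
control `V` there. The loss of one power of `ħ` comes from the uncertainty principle: expanding `‖(p
- i f)φ‖² ≥ 0` gives `ħ f' ≤ p² + f²` for every smooth real `f` (`integral_deriv_mul_norm_sq_le`).

The multiplier `f = M (1 - 2M/r)(r - r₀)/r²`, with `r₀ = r(x_max)`, vanishes at the top with
positive slope. It satisfies `f² ≤ W` (`escape_sq_le`) and `V ≤ κ f' + D W` (`semiPotential_le`).
Consequently, for `ħ ≤ 1`, `ħ H ≤ K (2p² + W)` as forms on test functions, with `K` depending only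
on `M` (`form_le_form_commutator`). This holds globally, with no localization in phase space or in
energy. On the range of `χ_I(H)` the form of `H` is at least `ε/2`, which yields the estimate with
`c₀ = ε/(2K)`; the upper end of `I` matters only because a bounded interval puts this range into the
domain of `H`.

The pointwise inequalities reduce to polynomial inequalities in `r`. Small `ħ` forces `L = ℓ(ℓ+1)`
to be large compared with `|σ|`, so that `r₀` is close to `3M`, and the normalization of `V` keeps
`ħ² L` comparable to `M²`.

The operator-theoretic part makes the form argument legitimate. `V` and `xV'` are bounded, and `[H,
A]` differs from a multiple of `H` by a bounded multiplication, so the inequality passes from test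
functions to the domain of `H` (`mem_domain_commutator_of_mem_domain`). Essential self-adjointness
follows from the dense range of `p² + a` on test functions and a small perturbation. The spectral
measure of `H` is built from the continuous functional calculus of the bounded inverse of `H + a`.
-/

theorem IsClosable.mem_graph_closure_iff (hT : T.IsClosable) {x y : 𝓗} :
    (x, y) ∈ T.closure.graph ↔ ∃ u : ℕ → T.domain,
      Tendsto (fun n => (u n : 𝓗)) atTop (𝓝 x) ∧ Tendsto (fun n => T (u n)) atTop (𝓝 y) := by
  rw [← hT.graph_closure_eq_closure_graph, ← SetLike.mem_coe, Submodule.topologicalClosure_coe,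
    mem_closure_iff_seq_limit]
  constructor
  · rintro ⟨v, hv, hlim⟩
    simp only [SetLike.mem_coe, mem_graph_iff] at hv
    choose u hu1 hu2 using hv
    refine ⟨u, ?_, ?_⟩
    · simp_rw [hu1]
      exact (continuous_fst.tendsto _).comp hlim
    · simp_rw [hu2]
      exact (continuous_snd.tendsto _).comp hlim
  · rintro ⟨u, h1, h2⟩
    refine ⟨fun n => (u n, T (u n)), fun n => T.mem_graph (u n), h1.prodMk_nhds h2⟩

theorem IsFormalAdjoint.closure (hc : T.IsClosable) (hs : T.IsFormalAdjoint T) :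
    T.closure.IsFormalAdjoint T.closure := by
  intro x y
  obtain ⟨u, hu1, hu2⟩ := hc.mem_graph_closure_iff.1 (T.closure.mem_graph x)
  obtain ⟨v, hv1, hv2⟩ := hc.mem_graph_closure_iff.1 (T.closure.mem_graph y)
  refine tendsto_nhds_unique (hu2.inner hv1) ?_
  simp_rw [hs (u _) (v _)]
  exact hu1.inner hv2

theorem IsClosable.mul_norm_le_norm_closure_add (hcl : T.IsClosable) {a c : ℝ}
    (hlow : ∀ x : T.domain, c * ‖(x : 𝓗)‖ ≤ ‖T x + (a : ℂ) • (x : 𝓗)‖) (x : T.closure.domain) :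
    c * ‖(x : 𝓗)‖ ≤ ‖T.closure x + (a : ℂ) • (x : 𝓗)‖ := by
  obtain ⟨u, h1, h2⟩ := hcl.mem_graph_closure_iff.1 (T.closure.mem_graph x)
  exact le_of_tendsto_of_tendsto' (h1.norm.const_mul c) (h2.add (h1.const_smul _)).norm
    fun n => hlow (u n)

variable [CompleteSpace 𝓗]

theorem IsFormalAdjoint.isClosable (hd : Dense (T.domain : Set 𝓗)) (hs : T.IsFormalAdjoint T) :
    T.IsClosable :=
  (adjoint_isClosed hd).isClosable.leIsClosable (hs.le_adjoint hd)

/-- A symmetric operator `T` such that `T + a` is surjective, for some real `a`, is self-adjoint. -/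
theorem IsFormalAdjoint.isSelfAdjoint_of_surjective (hd : Dense (T.domain : Set 𝓗))
    (hs : T.IsFormalAdjoint T) {a : ℝ}
    (hr : ∀ χ, ∃ x : T.domain, T x + (a : ℂ) • (x : 𝓗) = χ) : IsSelfAdjoint T := by
  rw [isSelfAdjoint_def]
  refine le_antisymm ?_ (hs.le_adjoint hd)
  refine le_of_le_graph ?_
  rintro ⟨y, w⟩ hyw
  obtain ⟨y, rfl, rfl⟩ := (LinearPMap.mem_graph_iff _).1 hyw
  obtain ⟨x, hx⟩ := hr (T† y + (a : ℂ) • (y : 𝓗))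
  -- By symmetry `x - y` is orthogonal to the range of `T + a`, which is the whole space.
  have hxy : (x : 𝓗) = y := by
    refine ext_inner_right ℂ fun χ => ?_
    obtain ⟨v, rfl⟩ := hr χ
    have h1 : inner ℂ (T x + (a : ℂ) • (x : 𝓗)) (v : 𝓗) =
        inner ℂ (T† y + (a : ℂ) • (y : 𝓗)) (v : 𝓗) := by rw [hx]
    rw [inner_add_left, inner_add_left, hs x v, adjoint_isFormalAdjoint hd y v, inner_smul_left,
      inner_smul_left, Complex.conj_ofReal] at h1
    rw [inner_add_right, inner_add_right, inner_smul_right, inner_smul_right]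
    exact h1
  refine (LinearPMap.mem_graph_iff _).2 ⟨x, hxy, ?_⟩
  rw [hxy] at hx
  exact add_right_cancel hx

/-- The lower bound makes preimages of a convergent sequence Cauchy, so the closure plus `a` has
closed range; density then gives surjectivity. -/
theorem IsClosable.exists_closure_add_eq (hcl : T.IsClosable) {a c : ℝ} (hc : 0 < c)
    (hlow : ∀ x : T.domain, c * ‖(x : 𝓗)‖ ≤ ‖T x + (a : ℂ) • (x : 𝓗)‖)
    (hr : DenseRange fun x : T.domain => T x + (a : ℂ) • (x : 𝓗)) (χ : 𝓗) :
    ∃ x : T.closure.domain, T.closure x + (a : ℂ) • (x : 𝓗) = χ := by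
  obtain ⟨s, hs1, hs2⟩ := mem_closure_iff_seq_limit.1 (hr χ)
  choose u hu using hs1
  simp only at hu
  have hcau : CauchySeq fun n => (u n : 𝓗) := by
    rw [Metric.cauchySeq_iff']
    intro δ hδ
    obtain ⟨N, hN⟩ := Metric.cauchySeq_iff'.1 hs2.cauchySeq (c * δ) (by positivity)
    refine ⟨N, fun n hn => ?_⟩
    have h1 := hlow (u n - u N)
    have h2 := hN n hn
    rw [dist_eq_norm, ← hu, ← hu] at h2
    rw [dist_eq_norm]
    have e : T (u n - u N) + (a : ℂ) • ((u n - u N : T.domain) : 𝓗)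
        = T (u n) + (a : ℂ) • (u n : 𝓗) - (T (u N) + (a : ℂ) • (u N : 𝓗)) := by
      rw [map_sub]
      push_cast
      rw [smul_sub]
      abel
    rw [e] at h1
    have h3 : c * ‖(u n : 𝓗) - u N‖ < c * δ := lt_of_le_of_lt (by simpa using h1) h2
    exact lt_of_mul_lt_mul_left h3 hc.le
  obtain ⟨x, hx⟩ := cauchySeq_tendsto_of_complete hcau
  have hmem : (x, χ - (a : ℂ) • x) ∈ T.closure.graph := by
    refine hcl.mem_graph_closure_iff.2 ⟨u, hx, (hs2.sub (hx.const_smul (a : ℂ))).congr fun n => ?_⟩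
    rw [← hu, add_sub_cancel_right]
  obtain ⟨y, hy1, hy2⟩ := (LinearPMap.mem_graph_iff _).1 hmem
  simp only at hy1 hy2
  exact ⟨y, by rw [hy2, hy1, sub_add_cancel]⟩

/-- If `T` is symmetric and `T + a` is surjective and bounded below, then `(T + a)⁻¹` is a bounded
self-adjoint operator. -/
theorem IsFormalAdjoint.exists_inverse (hs : T.IsFormalAdjoint T) {a c : ℝ} (hc : 0 < c)
    (hlow : ∀ x : T.domain, c * ‖(x : 𝓗)‖ ≤ ‖T x + (a : ℂ) • (x : 𝓗)‖)
    (hr : ∀ χ, ∃ x : T.domain, T x + (a : ℂ) • (x : 𝓗) = χ) :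
    ∃ R : 𝓗 →L[ℂ] 𝓗, IsSelfAdjoint R ∧ Function.Injective R ∧
      (∀ ψ, ψ ∈ T.domain ↔ ψ ∈ range R) ∧
        ∀ χ (h : R χ ∈ T.domain), T ⟨R χ, h⟩ = χ - (a : ℂ) • R χ := by
  let S : T.domain →ₗ[ℂ] 𝓗 := T.toFun + (a : ℂ) • T.domain.subtype
  have hS : ∀ x, S x = T x + (a : ℂ) • (x : 𝓗) := fun x => rfl
  have hinj : Function.Injective S := by
    refine (injective_iff_map_eq_zero S).2 fun x hx => ?_
    have h := hlow x
    rw [← hS, hx, norm_zero] at h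
    have h' : ‖(x : 𝓗)‖ ≤ 0 := nonpos_of_mul_nonpos_right h hc
    exact Subtype.ext (norm_le_zero_iff.1 h')
  let e : T.domain ≃ₗ[ℂ] 𝓗 := LinearEquiv.ofBijective S ⟨hinj, hr⟩
  have he : ∀ x, e x = T x + (a : ℂ) • (x : 𝓗) := fun x => rfl
  let R : 𝓗 →L[ℂ] 𝓗 := (T.domain.subtype ∘ₗ e.symm.toLinearMap).mkContinuous c⁻¹ fun χ => by
    have h := hlow (e.symm χ)
    rw [← he, e.apply_symm_apply] at h
    rw [inv_mul_eq_div, le_div_iff₀' hc]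
    exact h
  have hR : ∀ χ, R χ = (e.symm χ : 𝓗) := fun χ => rfl
  refine ⟨R, ContinuousLinearMap.isSelfAdjoint_iff_isSymmetric.2 fun φ ψ => ?_, fun φ ψ h => ?_,
    fun ψ => ⟨fun h => ⟨e ⟨ψ, h⟩, ?_⟩, ?_⟩, fun χ h => ?_⟩
  · obtain ⟨x, rfl⟩ := e.surjective φ
    obtain ⟨y, rfl⟩ := e.surjective ψ
    change inner ℂ (R (e x)) (e y) = inner ℂ (e x) (R (e y))
    rw [hR, hR, e.symm_apply_apply, e.symm_apply_apply, he, he, inner_add_left, inner_add_right,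
      hs x y, inner_smul_left, inner_smul_right, Complex.conj_ofReal]
  · exact e.symm.injective (Subtype.ext h)
  · rw [hR, e.symm_apply_apply]
  · rintro ⟨χ, rfl⟩
    exact (e.symm χ).2
  · have h1 := he (e.symm χ)
    rw [e.apply_symm_apply] at h1
    exact eq_sub_of_add_eq h1.symm

end LinearPMap

/-- A perturbation `B` that is small with respect to `A` preserves the density of the range. -/
theorem denseRange_add_of_norm_le {𝓗 D : Type*} [NormedAddCommGroup 𝓗] [InnerProductSpace ℂ 𝓗]
    [CompleteSpace 𝓗] [AddCommGroup D] [Module ℂ D] {A B : D →ₗ[ℂ] 𝓗} {q : ℝ} (hq0 : 0 ≤ q)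
    (hq : q < 1) (hB : ∀ x, ‖B x‖ ≤ q * ‖A x‖) (hA : DenseRange A) : DenseRange (A + B) := by
  have hA' : DenseRange (A + B) ↔ Dense ((LinearMap.range (A + B) : Submodule ℂ 𝓗) : Set 𝓗) := by
    rw [LinearMap.coe_range]; rfl
  rw [hA', Submodule.dense_iff_topologicalClosure_eq_top,
    Submodule.topologicalClosure_eq_top_iff, Submodule.eq_bot_iff]
  intro u hu
  rw [Submodule.mem_orthogonal'] at hu
  by_contra hne
  have hpos : 0 < ‖u‖ := norm_pos_iff.2 hne
  -- For `u` orthogonal to the range of `A + B`, an `A x` within `δ` of `u` gives `‖u‖ ≤ δ + q(‖u‖ +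
  -- δ)`. With `δ = (1 - q)‖u‖/2` this reads `(1 - q)² ≤ 0`, and the strict approximation leaves
  -- room to spare.
  obtain ⟨_, ⟨x, rfl⟩, hx⟩ := Metric.mem_closure_iff.1 (hA u) ((1 - q) / 2 * ‖u‖)
    (by have : 0 < 1 - q := by linarith
        positivity)
  have h0 : inner ℂ u ((A + B) x) = 0 := hu _ ⟨x, rfl⟩
  have h1 : inner ℂ u u = inner ℂ u (u - A x - B x) := by
    rw [LinearMap.add_apply, inner_add_right] at h0
    rw [inner_sub_right, inner_sub_right]
    linear_combination h0
  have h2 : ‖u‖ * ‖u‖ ≤ ‖u‖ * (‖u - A x‖ + ‖B x‖) := by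
    have h := norm_inner_le_norm (𝕜 := ℂ) u (u - A x - B x)
    rw [← h1, inner_self_eq_norm_sq_to_K] at h
    refine le_trans (le_of_eq ?_) (h.trans (mul_le_mul_of_nonneg_left (norm_sub_le _ _) hpos.le))
    simp [sq]
  have h3 : ‖A x‖ ≤ ‖u‖ + ‖u - A x‖ := by
    have := norm_sub_le u (u - A x)
    simpa using this
  rw [dist_eq_norm] at hx
  have h4 := hB x
  have h5 : ‖u‖ ≤ ‖u - A x‖ + ‖B x‖ := by
    exact le_of_mul_le_mul_left h2 hpos
  nlinarith [norm_nonneg (u - A x)]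

/-! ### Consequences of having a spectral measure -/

namespace Semiclassical

variable {𝓗 : Type*} [NormedAddCommGroup 𝓗] [InnerProductSpace ℂ 𝓗] [CompleteSpace 𝓗]

namespace IsSpectralMeasure

variable {T : 𝓗 →ₗ.[ℂ] 𝓗} {E : Set ℝ → 𝓗 →L[ℂ] 𝓗}

theorem inner_apply (hE : IsSpectralMeasure T E) {B : Set ℝ} (hB : MeasurableSet B) (ψ : 𝓗) :
    inner ℂ ψ (E B ψ) = ((‖E B ψ‖ ^ 2 : ℝ) : ℂ) := by
  have h := hE.isStarProjection B hB
  have h1 : E B (E B ψ) = E B ψ := congrArg (fun S : 𝓗 →L[ℂ] 𝓗 => S ψ) h.isIdempotentElem.eq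
  have h2 := (ContinuousLinearMap.isSelfAdjoint_iff_isSymmetric.1 h.isSelfAdjoint) ψ (E B ψ)
  simp only [ContinuousLinearMap.coe_coe] at h2
  rw [h1] at h2
  rw [← h2, inner_self_eq_norm_sq_to_K]
  push_cast
  rfl

theorem apply_empty (hE : IsSpectralMeasure T E) : E ∅ = 0 := by
  ext ψ
  obtain ⟨μ, -, hμ, -⟩ := hE.exists_measure ψ
  have h := hμ ∅ MeasurableSet.empty
  rw [hE.inner_apply MeasurableSet.empty] at h
  simp only [measureReal_empty, Complex.ofReal_zero] at h
  have h2 : ‖E ∅ ψ‖ ^ 2 = 0 := by exact_mod_cast h.symm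
  simpa using h2

/-- The range of the spectral projection of a bounded interval is contained in the domain, and the
quadratic form is bounded below there by the left end of the interval. -/
theorem range_apply_Icc (hE : IsSpectralMeasure T E) (a b : ℝ) (ψ : 𝓗) :
    ∃ h : E (Icc a b) ψ ∈ T.domain,
      ((a * ‖E (Icc a b) ψ‖ ^ 2 : ℝ) : ℂ) ≤ inner ℂ (E (Icc a b) ψ) (T ⟨E (Icc a b) ψ, h⟩) := by
  set χ := E (Icc a b) ψ with hχ
  obtain ⟨μ, hfin, hμ, hdom, hval⟩ := hE.exists_measure χ
  have hE1 : ∀ B, MeasurableSet B → E B χ = E (B ∩ Icc a b) ψ := fun B hB => by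
    rw [hE.apply_inter _ _ hB measurableSet_Icc]; rfl
  -- A vector in the range of `E (Icc a b)` has its scalar spectral measure supported in `Icc a b`;
  -- all moments are then finite and the first is at least `a` times the mass.
  have hnull : μ (Icc a b)ᶜ = 0 := by
    have h1 := hμ _ (measurableSet_Icc (a := a) (b := b)).compl
    rw [hE1 _ measurableSet_Icc.compl, compl_inter_self, hE.apply_empty] at h1
    simp only [zero_apply, inner_zero_right, Complex.ofReal_eq_zero] at h1
    exact (measureReal_eq_zero_iff).1 h1
  have hae : ∀ᵐ t ∂μ, t ∈ Icc a b := by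
    rw [ae_iff]; exact hnull
  have huniv : μ.real univ = ‖χ‖ ^ 2 := by
    have h1 := hμ univ MeasurableSet.univ
    rw [hE.inner_apply MeasurableSet.univ, hE.apply_univ] at h1
    exact_mod_cast h1
  have hbd : ∀ᵐ t ∂μ, |t| ≤ max |a| |b| := by
    filter_upwards [hae] with t ht
    exact abs_le_max_abs_abs ht.1 ht.2
  have hint2 : Integrable (fun t : ℝ => t ^ 2) μ := by
    refine Integrable.of_bound (by fun_prop) ((max |a| |b|) ^ 2) ?_
    filter_upwards [hbd] with t ht
    rw [Real.norm_eq_abs, abs_pow]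
    gcongr
  have hint : Integrable (fun t : ℝ => t) μ := by
    refine Integrable.of_bound (by fun_prop) (max |a| |b|) ?_
    filter_upwards [hbd] with t ht
    exact ht
  have hmem := hdom.2 hint2
  refine ⟨hmem, ?_⟩
  rw [hval hmem]
  have : a * ‖χ‖ ^ 2 ≤ ∫ t, t ∂μ := by
    have h1 : ∫ _, a ∂μ ≤ ∫ t, t ∂μ := by
      refine integral_mono_ae (integrable_const a) hint ?_
      filter_upwards [hae] with t ht
      exact ht.1
    rw [integral_const, smul_eq_mul, huniv] at h1
    linarith
  exact_mod_cast this

end IsSpectralMeasure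

end Semiclassical

namespace Semiclassical

/-! ### Operators on test functions -/

lemma testFn_differentiable (φ : TestFn) : Differentiable ℝ φ.1 :=
  (contDiff_infty_iff_deriv.1 φ.2.1).1

lemma testFn_continuous (φ : TestFn) : Continuous φ.1 := φ.2.1.continuous

lemma p_apply (hbar : ℝ) (φ : TestFn) (x : ℝ) :
    (p hbar φ).1 x = -Complex.I * hbar * deriv φ.1 x := rfl

lemma mulOp_apply {v : ℝ → ℝ} (hv : ContDiff ℝ ∞ v) (φ : TestFn) (x : ℝ) :
    (mulOp v hv φ).1 x = (v x : ℂ) * φ.1 x := rfl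

lemma p_p_apply (hbar : ℝ) (φ : TestFn) (x : ℝ) :
    (p hbar (p hbar φ)).1 x = -(hbar ^ 2 : ℝ) * deriv (deriv φ.1) x := by
  rw [p_apply]
  have : (p hbar φ).1 = fun y => -Complex.I * hbar * deriv φ.1 y := rfl
  rw [this, deriv_const_mul_field]
  push_cast
  linear_combination (hbar : ℂ) ^ 2 * deriv (deriv φ.1) x * Complex.I_sq

/-- The commutation relation `[p, v] = -iħ v'`. -/
lemma p_mulOp (hbar : ℝ) {v v' : ℝ → ℝ} (hv : ContDiff ℝ ∞ v) (hv' : ContDiff ℝ ∞ v')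
    (h : ∀ x, HasDerivAt v (v' x) x) (φ : TestFn) :
    p hbar (mulOp v hv φ) =
      mulOp v hv (p hbar φ) - (Complex.I * hbar) • mulOp v' hv' φ := by
  ext x
  have h1 : HasDerivAt (fun y => (v y : ℂ) * φ.1 y) ((v' x : ℂ) * φ.1 x + v x * deriv φ.1 x) x :=
    (h x).ofReal_comp.mul (testFn_differentiable φ x).hasDerivAt
  have h2 : deriv (mulOp v hv φ).1 x = (v' x : ℂ) * φ.1 x + v x * deriv φ.1 x := h1.deriv
  rw [p_apply, h2]
  simp only [Submodule.coe_sub, Submodule.coe_smul, Pi.sub_apply, Pi.smul_apply, smul_eq_mul,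
    mulOp_apply, p_apply]
  ring

lemma mulOp_mulOp {v w : ℝ → ℝ} (hv : ContDiff ℝ ∞ v) (hw : ContDiff ℝ ∞ w) (φ : TestFn) :
    mulOp v hv (mulOp w hw φ) = mulOp (fun x => v x * w x) (hv.mul hw) φ := by
  ext x
  simp only [mulOp_apply]
  push_cast
  ring

/-- The commutator of `p² + v` with the generator of dilations is `2p² - x v'`. -/
lemma scaledCommutator_schrodinger_dilation {hbar : ℝ} (hh : hbar ≠ 0) {v v' : ℝ → ℝ}
    (hv : ContDiff ℝ ∞ v) (hv' : ContDiff ℝ ∞ v') (h : ∀ x, HasDerivAt v (v' x) x)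
    (φ : TestFn) :
    scaledCommutator hbar (schrodinger hbar v hv) (dilation hbar) φ =
      (2 : ℂ) • p hbar (p hbar φ) - mulOp (fun x => x * v' x) (contDiff_id.mul hv') φ := by
  have hX : ∀ ψ, p hbar (pos ψ) = pos (p hbar ψ) - (Complex.I * hbar) • ψ := fun ψ => by
    rw [pos, p_mulOp hbar (v := fun x => x) contDiff_id contDiff_const (fun x => hasDerivAt_id x)]
    congr 2
    ext x
    simp [mulOp_apply]
  have hV := p_mulOp hbar hv hv' h
  have hXV : ∀ ψ, mulOp v hv (pos ψ) = pos (mulOp v hv ψ) := fun ψ => by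
    ext x
    simp only [pos, mulOp_apply]
    ring
  have hW : mulOp (fun x => x * v' x) (contDiff_id.mul hv') φ = pos (mulOp v' hv' φ) := by
    rw [pos, mulOp_mulOp]
  have hne : (hbar : ℂ) ≠ 0 := by exact_mod_cast hh
  rw [hW]
  simp only [scaledCommutator, schrodinger, dilation, sq, LinearMap.smul_apply,
    LinearMap.sub_apply, Module.End.mul_apply, LinearMap.add_apply, map_add, map_sub, map_smul,
    hX, hV, hXV, smul_add, smul_sub]
  match_scalars <;> field_simp <;> ring_nf <;> simp [Complex.I_sq]

/-! ### Operators in `L²` -/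

lemma inner_toL2 (φ ψ : TestFn) :
    inner ℂ (toL2 φ) (toL2 ψ) = ∫ x, starRingEnd ℂ (φ.1 x) * ψ.1 x := by
  rw [L2.inner_def]
  refine integral_congr_ae ?_
  filter_upwards [(testFn_memLp φ).coeFn_toLp, (testFn_memLp ψ).coeFn_toLp] with x h1 h2
  change inner ℂ (((testFn_memLp φ).toLp φ.1 : L2) x) (((testFn_memLp ψ).toLp ψ.1 : L2) x) = _
  rw [h1, h2, RCLike.inner_apply, mul_comm]

lemma integrable_conj_mul (φ ψ : TestFn) :
    Integrable fun x => starRingEnd ℂ (φ.1 x) * ψ.1 x :=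
  ((Complex.continuous_conj.comp (testFn_continuous φ)).mul (testFn_continuous ψ)).integrable_of_hasCompactSupport
    (HasCompactSupport.mul_left (f := fun x => starRingEnd ℂ (φ.1 x)) ψ.2.2)

lemma inner_toL2_mulOp {v : ℝ → ℝ} (hv : ContDiff ℝ ∞ v) (φ : TestFn) :
    inner ℂ (toL2 φ) (toL2 (mulOp v hv φ)) = ((∫ x, v x * ‖φ.1 x‖ ^ 2 : ℝ) : ℂ) := by
  rw [inner_toL2, ← integral_complex_ofReal]
  refine integral_congr_ae (.of_forall fun x => ?_)
  simp only [mulOp_apply]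
  push_cast
  rw [← Complex.conj_mul']
  ring

lemma integrable_mul_norm_sq {v : ℝ → ℝ} (hv : Continuous v) (φ : TestFn) :
    Integrable fun x => v x * ‖φ.1 x‖ ^ 2 := by
  have h : HasCompactSupport fun x => ‖φ.1 x‖ ^ 2 :=
    φ.2.2.comp_left (g := fun z : ℂ => ‖z‖ ^ 2) (by simp)
  exact (hv.mul ((testFn_continuous φ).norm.pow 2)).integrable_of_hasCompactSupport h.mul_left

lemma inner_p_left (hbar : ℝ) (φ ψ : TestFn) :
    inner ℂ (toL2 (p hbar φ)) (toL2 ψ) = inner ℂ (toL2 φ) (toL2 (p hbar ψ)) := by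
  rw [inner_toL2, inner_toL2]
  have hparts := integral_mul_deriv_eq_deriv_mul_of_integrable
    (u := fun x => starRingEnd ℂ (φ.1 x)) (v := ψ.1)
    (u' := fun x => starRingEnd ℂ (deriv φ.1 x)) (v' := deriv ψ.1)
    (fun x _ => (testFn_differentiable φ x).hasDerivAt.star) (fun x _ => (testFn_differentiable ψ x).hasDerivAt)
    (integrable_conj_mul φ ⟨deriv ψ.1, (contDiff_infty_iff_deriv.1 ψ.2.1).2, ψ.2.2.deriv⟩)
    (integrable_conj_mul ⟨deriv φ.1, (contDiff_infty_iff_deriv.1 φ.2.1).2, φ.2.2.deriv⟩ ψ)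
    (integrable_conj_mul φ ψ)
  have h1 : ∀ x, starRingEnd ℂ ((p hbar φ).1 x) * ψ.1 x
      = (Complex.I * hbar) * (starRingEnd ℂ (deriv φ.1 x) * ψ.1 x) := fun x => by
    rw [p_apply]
    simp
    ring
  have h2 : ∀ x, starRingEnd ℂ (φ.1 x) * (p hbar ψ).1 x
      = -(Complex.I * hbar) * (starRingEnd ℂ (φ.1 x) * deriv ψ.1 x) := fun x => by
    rw [p_apply]
    ring
  simp_rw [h1, h2]
  rw [integral_const_mul, integral_const_mul, hparts]
  ring

lemma inner_mulOp_left {v : ℝ → ℝ} (hv : ContDiff ℝ ∞ v) (φ ψ : TestFn) :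
    inner ℂ (toL2 (mulOp v hv φ)) (toL2 ψ) = inner ℂ (toL2 φ) (toL2 (mulOp v hv ψ)) := by
  rw [inner_toL2, inner_toL2]
  refine integral_congr_ae (.of_forall fun x => ?_)
  simp only [mulOp_apply, map_mul, Complex.conj_ofReal]
  ring

lemma inner_schrodinger_left (hbar : ℝ) {v : ℝ → ℝ} (hv : ContDiff ℝ ∞ v) (φ ψ : TestFn) :
    inner ℂ (toL2 (schrodinger hbar v hv φ)) (toL2 ψ) =
      inner ℂ (toL2 φ) (toL2 (schrodinger hbar v hv ψ)) := by
  simp only [schrodinger, sq, LinearMap.add_apply, Module.End.mul_apply, map_add, inner_add_left,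
    inner_add_right, inner_p_left, inner_mulOp_left]

lemma norm_toL2_mulOp_le {v : ℝ → ℝ} (hv : ContDiff ℝ ∞ v) {b : ℝ} (hb : ∀ x, |v x| ≤ b)
    (φ : TestFn) : ‖toL2 (mulOp v hv φ)‖ ≤ b * ‖toL2 φ‖ := by
  refine Lp.norm_le_mul_norm_of_ae_le_mul ?_
  filter_upwards [(testFn_memLp φ).coeFn_toLp, (testFn_memLp (mulOp v hv φ)).coeFn_toLp]
    with x h1 h2
  change ‖((testFn_memLp (mulOp v hv φ)).toLp (mulOp v hv φ).1 : L2) x‖ ≤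
    b * ‖((testFn_memLp φ).toLp φ.1 : L2) x‖
  rw [h1, h2, mulOp_apply, norm_mul, Complex.norm_real]
  exact mul_le_mul_of_nonneg_right (hb x) (norm_nonneg _)

/-- The lower bound `ħ f' ≤ p² + f²`, an instance of the uncertainty principle. -/
lemma integral_deriv_mul_norm_sq_le (hbar : ℝ) {f f' : ℝ → ℝ} (hf : ContDiff ℝ ∞ f)
    (hf' : ContDiff ℝ ∞ f') (h : ∀ x, HasDerivAt f (f' x) x) (φ : TestFn) :
    hbar * ∫ x, f' x * ‖φ.1 x‖ ^ 2 ≤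
      ‖toL2 (p hbar φ)‖ ^ 2 + ∫ x, f x ^ 2 * ‖φ.1 x‖ ^ 2 := by
  set P := toL2 (p hbar φ) with hP
  set Q := toL2 (mulOp f hf φ) with hQ
  -- The cross terms of this square combine to the commutator `[p, f] = -iħ f'`.
  have h0 : (0 : ℝ) ≤ ‖P - Complex.I • Q‖ ^ 2 := by positivity
  have h1 : ((‖P - Complex.I • Q‖ ^ 2 : ℝ) : ℂ) = ((‖P‖ ^ 2 : ℝ) : ℂ)
      + ((∫ x, f x ^ 2 * ‖φ.1 x‖ ^ 2 : ℝ) : ℂ) - ((hbar * ∫ x, f' x * ‖φ.1 x‖ ^ 2 : ℝ) : ℂ) := by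
    have e1 : ∀ z : L2, ((‖z‖ ^ 2 : ℝ) : ℂ) = inner ℂ z z := fun z => by
      rw [inner_self_eq_norm_sq_to_K]
      push_cast
      rfl
    have eQ : inner ℂ Q Q = ((∫ x, f x ^ 2 * ‖φ.1 x‖ ^ 2 : ℝ) : ℂ) := by
      rw [hQ, inner_mulOp_left, mulOp_mulOp, inner_toL2_mulOp]
      simp_rw [sq]
    have ePQ : inner ℂ P Q = inner ℂ Q P
        - (Complex.I * hbar) * ((∫ x, f' x * ‖φ.1 x‖ ^ 2 : ℝ) : ℂ) := by
      rw [hP, hQ, inner_p_left, p_mulOp hbar hf hf' h, map_sub, map_smul, inner_sub_right,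
        inner_smul_right, inner_mulOp_left, inner_toL2_mulOp]
    rw [e1, e1, inner_sub_left, inner_sub_right, inner_sub_right, inner_smul_left,
      inner_smul_right, inner_smul_left, inner_smul_right, eQ, ePQ, Complex.conj_I]
    push_cast
    linear_combination ((hbar : ℂ) * ((∫ x, f' x * ‖φ.1 x‖ ^ 2 : ℝ) : ℂ) - ((∫ x, f x ^ 2 * ‖φ.1 x‖ ^ 2 : ℝ) : ℂ)) * Complex.I_sq
  have h2 : ‖P - Complex.I • Q‖ ^ 2 = ‖P‖ ^ 2 + (∫ x, f x ^ 2 * ‖φ.1 x‖ ^ 2)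
      - hbar * ∫ x, f' x * ‖φ.1 x‖ ^ 2 := by exact_mod_cast h1
  linarith

end Semiclassical

namespace Semiclassical

/-! ### Essential self-adjointness of Schrödinger operators with bounded potential -/

open scoped SchwartzMap FourierTransform LineDeriv

lemma lineDerivOp_one_apply (u : 𝓢(ℝ, ℂ)) (x : ℝ) : (∂_{(1 : ℝ)} u) x = deriv u x := by
  rw [SchwartzMap.lineDerivOp_apply_eq_fderiv, fderiv_apply_one_eq_deriv]

lemma hasDerivAt_schwartz (u : 𝓢(ℝ, ℂ)) (x : ℝ) : HasDerivAt u ((∂_{(1 : ℝ)} u) x) x := by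
  rw [lineDerivOp_one_apply]
  exact u.hasDerivAt x

lemma fourier_lineDerivOp_one_apply (u : 𝓢(ℝ, ℂ)) (ξ : ℝ) :
    (𝓕 (∂_{(1 : ℝ)} u) : 𝓢(ℝ, ℂ)) ξ = 2 * Real.pi * Complex.I * ξ * (𝓕 u : 𝓢(ℝ, ℂ)) ξ := by
  rw [SchwartzMap.fourier_lineDerivOp_eq, smul_apply,
    SchwartzMap.smulLeftCLM_apply_apply (by fun_prop)]
  simp
  ring

/-- The equation `-ħ² u'' + a u = g` is solvable in the Schwartz space for `a > 0`. -/
lemma exists_schwartz_resolvent {hbar a : ℝ} (ha : 0 < a) (g : 𝓢(ℝ, ℂ)) :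
    ∃ u : 𝓢(ℝ, ℂ), (a : ℂ) • u - ((hbar ^ 2 : ℝ) : ℂ) • ∂_{(1 : ℝ)} (∂_{(1 : ℝ)} u) = g := by
  -- `m ξ = a / (a + (2πħξ)²)`, so `m / a` is the Fourier multiplier of the resolvent. The form `(1
  -- + |cξ|²)⁻¹` makes its temperate growth immediate.
  set c : ℝ := 2 * Real.pi * hbar / Real.sqrt a with hc
  set m : ℝ → ℝ := fun ξ => (1 + ‖(c • ContinuousLinearMap.id ℝ ℝ) ξ‖ ^ 2) ^ (-1 : ℝ) with hm
  have hmg : m.HasTemperateGrowth := by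
    exact (Function.hasTemperateGrowth_one_add_norm_sq_rpow ℝ (-1)).comp
      (c • ContinuousLinearMap.id ℝ ℝ).hasTemperateGrowth
  have hmv : ∀ ξ, (a + (2 * Real.pi * hbar * ξ) ^ 2) * m ξ = a := fun ξ => by
    have h1 : m ξ = (1 + (c * ξ) ^ 2)⁻¹ := by
      simp only [hm]
      rw [Real.rpow_neg_one]
      simp [mul_pow]
    have h2 : (c * ξ) ^ 2 = (2 * Real.pi * hbar * ξ) ^ 2 / a := by
      rw [hc, div_mul_eq_mul_div, div_pow, Real.sq_sqrt ha.le]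
    rw [h1, h2]
    have : (0 : ℝ) < a + (2 * Real.pi * hbar * ξ) ^ 2 := by positivity
    field_simp
  refine ⟨((a⁻¹ : ℝ) : ℂ) • 𝓕⁻ (SchwartzMap.smulLeftCLM ℂ m (𝓕 g)), ?_⟩
  set w : 𝓢(ℝ, ℂ) := 𝓕⁻ (SchwartzMap.smulLeftCLM ℂ m (𝓕 g)) with hw
  have hFw : ∀ ξ : ℝ, (𝓕 w : 𝓢(ℝ, ℂ)) ξ = (m ξ : ℂ) * (𝓕 g : 𝓢(ℝ, ℂ)) ξ := fun ξ => by
    rw [hw, FourierTransform.fourier_fourierInv_eq, SchwartzMap.smulLeftCLM_apply_apply hmg]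
    simp
  have hinj : ∀ u v : 𝓢(ℝ, ℂ), (𝓕 u : 𝓢(ℝ, ℂ)) = 𝓕 v → u = v := fun u v h => by
    have hl : ∀ z : 𝓢(ℝ, ℂ), 𝓕⁻ (𝓕 z : 𝓢(ℝ, ℂ)) = z := fun z =>
      FourierTransform.fourierInv_fourier_eq z
    rw [← hl u, h, hl]
  apply hinj
  ext ξ
  set u := ((a⁻¹ : ℝ) : ℂ) • w with hu
  have hFu : (𝓕 u : 𝓢(ℝ, ℂ)) ξ = ((a⁻¹ : ℝ) : ℂ) * (m ξ * (𝓕 g : 𝓢(ℝ, ℂ)) ξ) := by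
    rw [hu, FourierTransform.fourier_smul, smul_apply, hFw]
    rfl
  have e : (𝓕 ((a : ℂ) • u - ((hbar ^ 2 : ℝ) : ℂ) • ∂_{(1 : ℝ)} (∂_{(1 : ℝ)} u)) : 𝓢(ℝ, ℂ)) ξ
      = (a : ℂ) * (𝓕 u : 𝓢(ℝ, ℂ)) ξ - ((hbar ^ 2 : ℝ) : ℂ) * (𝓕 (∂_{(1 : ℝ)} (∂_{(1 : ℝ)} u)) : 𝓢(ℝ, ℂ)) ξ := by
    rw [sub_eq_add_neg, ← neg_smul, FourierTransform.fourier_add, FourierTransform.fourier_smul,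
      FourierTransform.fourier_smul]
    simp
    ring
  rw [e, fourier_lineDerivOp_one_apply, fourier_lineDerivOp_one_apply, hFu]
  have h3 : ((a : ℂ) + (2 * Real.pi * hbar * ξ) ^ 2) * m ξ = a := by exact_mod_cast hmv ξ
  have ha' : (a : ℂ) ≠ 0 := by exact_mod_cast ha.ne'
  push_cast
  field_simp
  ring_nf
  rw [Complex.I_sq]
  linear_combination ((𝓕 g : 𝓢(ℝ, ℂ)) ξ) * h3

/-- Multiplication of a Schwartz function by a smooth compactly supported function. -/
def cutoff (χ : ℝ → ℝ) (hχ : ContDiff ℝ ∞ χ) (hs : HasCompactSupport χ) (u : 𝓢(ℝ, ℂ)) : TestFn :=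
  ⟨fun x => (χ x : ℂ) * u x, (Complex.ofRealCLM.contDiff.comp hχ).mul (u.smooth ⊤), by
    have h : HasCompactSupport fun x => (χ x : ℂ) := hs.comp_left (g := Complex.ofReal) rfl
    exact h.mul_right⟩

lemma p_p_cutoff_apply (hbar : ℝ) {χ χ' χ'' : ℝ → ℝ} (hχ : ContDiff ℝ ∞ χ)
    (hs : HasCompactSupport χ) (h1 : ∀ x, HasDerivAt χ (χ' x) x)
    (h2 : ∀ x, HasDerivAt χ' (χ'' x) x) (u : 𝓢(ℝ, ℂ)) (x : ℝ) :
    (p hbar (p hbar (cutoff χ hχ hs u))).1 x = -(hbar ^ 2 : ℝ) *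
      (χ'' x * u x + 2 * χ' x * (∂_{(1 : ℝ)} u) x +
        χ x * (∂_{(1 : ℝ)} (∂_{(1 : ℝ)} u)) x) := by
  have e1 : deriv (cutoff χ hχ hs u).1 = fun y => (χ' y : ℂ) * u y + χ y * (∂_{(1 : ℝ)} u) y := by
    ext y
    exact ((h1 y).ofReal_comp.mul (hasDerivAt_schwartz u y)).deriv
  have e2 : deriv (fun y => (χ' y : ℂ) * u y + χ y * (∂_{(1 : ℝ)} u) y) x =
      (χ'' x * u x + χ' x * (∂_{(1 : ℝ)} u) x) +
        (χ' x * (∂_{(1 : ℝ)} u) x + χ x * (∂_{(1 : ℝ)} (∂_{(1 : ℝ)} u)) x) :=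
    (((h2 x).ofReal_comp.mul (hasDerivAt_schwartz u x)).add
      ((h1 x).ofReal_comp.mul (hasDerivAt_schwartz _ x))).deriv
  rw [p_p_apply, e1, e2]
  ring

/-- The linear bound is chosen so that replacing `g` by `b(t x) g` costs at most `t |x| |g|`, which
is square integrable for Schwartz `g`. -/
lemma exists_bump : ∃ b : ℝ → ℝ, ContDiff ℝ ∞ b ∧ HasCompactSupport b ∧
    ∀ x, |b x - 1| ≤ |x| := by
  let b : ContDiffBump (0 : ℝ) := ⟨1, 2, one_pos, one_lt_two⟩
  refine ⟨b, b.contDiff, b.hasCompactSupport, fun x => ?_⟩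
  by_cases h : |x| ≤ 1
  · have : b x = 1 := b.one_of_mem_closedBall (by simpa [b] using h)
    rw [this, sub_self, abs_zero]
    positivity
  · push Not at h
    have h3 : 0 ≤ b x := b.nonneg
    have h4 : b x ≤ 1 := b.le_one
    rw [abs_le]
    constructor <;> linarith

/-- Each error term carries a factor `t`: one from `|b(tx) - 1| ≤ t|x|`, one from the first
derivative of the cutoff, and `t² ≤ t` from the second. -/
lemma norm_cutoff_error_le {hbar t x β β₁ β₂ C₁ C₂ : ℝ} (ht0 : 0 < t) (ht1 : t ≤ 1)
    (hβ : |β| ≤ |t * x|) (hβ₁ : ‖β₁‖ ≤ C₁) (hβ₂ : ‖β₂‖ ≤ C₂) (g u₁ u : ℂ) :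
    ‖(β : ℂ) * g + (-(hbar ^ 2 * (2 * (t * β₁))) : ℝ) * u₁ +
      (-(hbar ^ 2 * (t ^ 2 * β₂)) : ℝ) * u‖ ≤
      t * (|x| * ‖g‖ + hbar ^ 2 * (2 * C₁) * ‖u₁‖ + hbar ^ 2 * C₂ * ‖u‖) := by
  have hC₂ : 0 ≤ C₂ := (norm_nonneg _).trans hβ₂
  rw [Real.norm_eq_abs] at hβ₁ hβ₂
  rw [abs_mul, abs_of_pos ht0] at hβ
  refine (norm_add₃_le).trans ?_
  rw [norm_mul, norm_mul, norm_mul, Complex.norm_real, Complex.norm_real, Complex.norm_real]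
  simp only [Real.norm_eq_abs]
  have k2 : |(-(hbar ^ 2 * (2 * (t * β₁))))| ≤ t * (hbar ^ 2 * (2 * C₁)) := by
    rw [abs_neg, abs_mul, abs_mul, abs_mul, abs_of_pos ht0, abs_two, abs_of_nonneg (sq_nonneg _)]
    calc hbar ^ 2 * (2 * (t * |β₁|)) ≤ hbar ^ 2 * (2 * (t * C₁)) := by gcongr
      _ = _ := by ring
  have k3 : |(-(hbar ^ 2 * (t ^ 2 * β₂)))| ≤ t * (hbar ^ 2 * C₂) := by
    rw [abs_neg, abs_mul, abs_mul, abs_of_nonneg (sq_nonneg t), abs_of_nonneg (sq_nonneg hbar)]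
    have htt : t ^ 2 ≤ t := by nlinarith
    calc hbar ^ 2 * (t ^ 2 * |β₂|) ≤ hbar ^ 2 * (t * C₂) := by gcongr
      _ = _ := by ring
  have k1' := mul_le_mul_of_nonneg_right hβ (norm_nonneg g)
  have k2' := mul_le_mul_of_nonneg_right k2 (norm_nonneg u₁)
  have k3' := mul_le_mul_of_nonneg_right k3 (norm_nonneg u)
  linarith

/-- The error made by cutting off a Schwartz function at distance `1 / t`. -/
lemma exists_testFn_norm_sub_le (hbar a : ℝ) (u g : 𝓢(ℝ, ℂ))
    (hg : ∀ x, g x = a * u x - (hbar ^ 2 : ℝ) * (∂_{(1 : ℝ)} (∂_{(1 : ℝ)} u)) x) :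
    ∃ G : ℝ → ℝ, MemLp G 2 (volume : Measure ℝ) ∧ ∀ t : ℝ, 0 < t → t ≤ 1 → ∃ φ : TestFn,
      ∀ x, ‖(p hbar (p hbar φ)).1 x + a * φ.1 x - g x‖ ≤ t * ‖G x‖ := by
  obtain ⟨b, hb, hbs, hb1⟩ := exists_bump
  have hb' := (contDiff_infty_iff_deriv.1 hb)
  have hb'' := (contDiff_infty_iff_deriv.1 hb'.2)
  obtain ⟨C₁, hC₁⟩ := hbs.deriv.exists_bound_of_continuous hb'.2.continuous
  obtain ⟨C₂, hC₂⟩ := hbs.deriv.deriv.exists_bound_of_continuous hb''.2.continuous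
  obtain ⟨xg, hxg⟩ : ∃ xg : 𝓢(ℝ, ℂ), ∀ x, ‖xg x‖ = |x| * ‖g x‖ := by
    refine ⟨SchwartzMap.smulLeftCLM ℂ (fun x : ℝ => x) g, fun x => ?_⟩
    rw [SchwartzMap.smulLeftCLM_apply_apply (by fun_prop), norm_smul, Real.norm_eq_abs]
  refine ⟨fun x => ‖xg x‖ + hbar ^ 2 * (2 * C₁) * ‖(∂_{(1 : ℝ)} u) x‖ +
    hbar ^ 2 * C₂ * ‖u x‖, ?_, fun t ht0 ht1 => ?_⟩
  · exact ((xg.memLp 2 volume).norm.add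
      (((∂_{(1 : ℝ)} u).memLp 2 volume).norm.const_mul _)).add
      ((u.memLp 2 volume).norm.const_mul _)
  have hχ : ContDiff ℝ ∞ fun x => b (t * x) := hb.comp (contDiff_const.mul contDiff_id)
  have hχs : HasCompactSupport fun x => b (t * x) :=
    hbs.comp_homeomorph (Homeomorph.mulLeft₀ t ht0.ne')
  have h1 : ∀ x, HasDerivAt (fun x => b (t * x)) (t * deriv b (t * x)) x := fun x => by
    have := HasDerivAt.comp x (hb'.1 (t * x)).hasDerivAt (hasDerivAt_const_mul t)
    rwa [mul_comm] at this
  have h2 : ∀ x, HasDerivAt (fun x => t * deriv b (t * x)) (t ^ 2 * deriv (deriv b) (t * x)) x :=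
    fun x => by
      have := (HasDerivAt.comp x (hb''.1 (t * x)).hasDerivAt (hasDerivAt_const_mul t)).const_mul t
      rwa [mul_comm _ t, ← mul_assoc, ← sq] at this
  refine ⟨cutoff _ hχ hχs u, fun x => ?_⟩
  have e : (p hbar (p hbar (cutoff _ hχ hχs u))).1 x + a * (cutoff _ hχ hχs u).1 x - g x =
      (b (t * x) - 1 : ℝ) * g x +
      (-(hbar ^ 2 * (2 * (t * deriv b (t * x)))) : ℝ) * (∂_{(1 : ℝ)} u) x +
      (-(hbar ^ 2 * (t ^ 2 * deriv (deriv b) (t * x))) : ℝ) * u x := by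
    rw [p_p_cutoff_apply hbar hχ hχs h1 h2, hg]
    have : (cutoff _ hχ hχs u).1 x = b (t * x) * u x := rfl
    rw [this]
    push_cast
    ring
  have hC₁0 : 0 ≤ C₁ := (norm_nonneg _).trans (hC₁ 0)
  have hC₂0 : 0 ≤ C₂ := (norm_nonneg _).trans (hC₂ 0)
  rw [e, Real.norm_of_nonneg (by positivity)]
  beta_reduce
  rw [hxg]
  exact norm_cutoff_error_le ht0 ht1 (hb1 _) (hC₁ _) (hC₂ _) _ _ _

/-- The smooth compactly supported functions are a core for `p²`. -/
lemma exists_testFn_norm_sub_lt (hbar a : ℝ) (u g : 𝓢(ℝ, ℂ))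
    (hg : ∀ x, g x = a * u x - (hbar ^ 2 : ℝ) * (∂_{(1 : ℝ)} (∂_{(1 : ℝ)} u)) x)
    {δ : ℝ} (hδ : 0 < δ) :
    ∃ φ : TestFn, ‖toL2 (p hbar (p hbar φ) + (a : ℂ) • φ) - g.toLp 2 volume‖ < δ := by
  obtain ⟨G, hG, h⟩ := exists_testFn_norm_sub_le hbar a u g hg
  set N := ‖hG.toLp G‖ with hN
  set t : ℝ := min 1 (δ / (2 * (N + 1))) with ht
  have hN0 : 0 ≤ N := norm_nonneg _
  have ht0 : 0 < t := lt_min one_pos (by positivity)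
  have htN : t * N < δ := by
    have h1 : t * (2 * (N + 1)) ≤ δ := by
      rw [← le_div_iff₀ (by positivity)]
      exact min_le_right _ _
    nlinarith
  obtain ⟨φ, hφ⟩ := h t ht0 (min_le_left _ _)
  refine ⟨φ, lt_of_le_of_lt ?_ htN⟩
  refine Lp.norm_le_mul_norm_of_ae_le_mul ?_
  have a1 := (testFn_memLp (p hbar (p hbar φ) + (a : ℂ) • φ)).coeFn_toLp
  filter_upwards [a1, g.coeFn_toLp 2 volume, hG.coeFn_toLp, Lp.coeFn_sub
    (toL2 (p hbar (p hbar φ) + (a : ℂ) • φ)) (g.toLp 2 volume)] with x h1 h2 h3 h4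
  rw [h4, Pi.sub_apply, h2, h3]
  change ‖((testFn_memLp (p hbar (p hbar φ) + (a : ℂ) • φ)).toLp _ : L2) x - g x‖ ≤ _
  rw [h1]
  exact hφ x

lemma denseRange_toL2 : DenseRange toL2 := by
  intro f
  refine Metric.mem_closure_iff.2 fun ε hε => ?_
  obtain ⟨g, hg1, hg2, hg3⟩ := (Lp.memLp f).exist_eLpNorm_sub_le (by simp) (by norm_num)
    (half_pos hε)
  refine ⟨_, ⟨⟨g, hg2, hg1⟩, rfl⟩, ?_⟩
  have h1 : (f : ℝ → ℂ) - ((toL2 ⟨g, hg2, hg1⟩ : L2) : ℝ → ℂ) =ᵐ[volume] (f : ℝ → ℂ) - g := by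
    filter_upwards [(testFn_memLp ⟨g, hg2, hg1⟩).coeFn_toLp] with x hx
    rw [Pi.sub_apply, Pi.sub_apply]
    congr 1
  rw [Lp.dist_def, eLpNorm_congr_ae h1]
  refine lt_of_le_of_lt (ENNReal.toReal_mono (by simp) hg3) ?_
  rw [ENNReal.toReal_ofReal (half_pos hε).le]
  linarith

/-- Schwartz functions are dense, each is `(p² + a)u` for some Schwartz `u`, and cutting off `u`
changes this by little in `L²`. -/
lemma denseRange_p_sq_add {hbar a : ℝ} (ha : 0 < a) :
    DenseRange (toL2 ∘ₗ (p hbar ^ 2 + (a : ℂ) • 1)) := by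
  intro f
  refine Metric.mem_closure_iff.2 fun ε hε => ?_
  obtain ⟨_, ⟨g, rfl⟩, hg⟩ := Metric.mem_closure_iff.1
    (SchwartzMap.denseRange_toLpCLM (E := ℝ) (F := ℂ) (p := 2) (μ := volume) (by simp) f)
    (ε / 2) (half_pos hε)
  obtain ⟨u, hu⟩ := exists_schwartz_resolvent (hbar := hbar) ha g
  obtain ⟨φ, hφ⟩ := exists_testFn_norm_sub_lt hbar a u g (fun x => by rw [← hu]; rfl)
    (half_pos hε)
  refine ⟨_, ⟨φ, rfl⟩, ?_⟩
  have e : (toL2 ∘ₗ (p hbar ^ 2 + (a : ℂ) • 1)) φ = toL2 (p hbar (p hbar φ) + (a : ℂ) • φ) := by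
    rw [LinearMap.comp_apply, LinearMap.add_apply, sq]
    rfl
  rw [← dist_eq_norm, dist_comm] at hφ
  rw [e]
  calc _ ≤ _ := dist_triangle _ _ _
    _ < ε / 2 + ε / 2 := add_lt_add hg hφ
    _ = ε := add_halves ε

lemma inner_p_sq (hbar : ℝ) (φ : TestFn) :
    inner ℂ (toL2 φ) (toL2 (p hbar (p hbar φ))) = ((‖toL2 (p hbar φ)‖ ^ 2 : ℝ) : ℂ) := by
  rw [← inner_p_left, inner_self_eq_norm_sq_to_K]
  push_cast
  rfl

/-- Pairing with `φ` and dropping the nonnegative `p²` leaves Cauchy–Schwarz. -/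
lemma mul_norm_le_norm_p_sq_add (hbar : ℝ) {a : ℝ} (φ : TestFn) :
    a * ‖toL2 φ‖ ≤ ‖toL2 (p hbar (p hbar φ)) + (a : ℂ) • toL2 φ‖ := by
  by_cases h0 : ‖toL2 φ‖ = 0
  · rw [h0, mul_zero]
    exact norm_nonneg _
  have hpos : 0 < ‖toL2 φ‖ := lt_of_le_of_ne (norm_nonneg _) (Ne.symm h0)
  have h1 := norm_inner_le_norm (𝕜 := ℂ) (toL2 φ)
    (toL2 (p hbar (p hbar φ)) + (a : ℂ) • toL2 φ)
  have h2 : inner ℂ (toL2 φ) (toL2 (p hbar (p hbar φ)) + (a : ℂ) • toL2 φ) =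
      ((‖toL2 (p hbar φ)‖ ^ 2 + a * ‖toL2 φ‖ ^ 2 : ℝ) : ℂ) := by
    rw [inner_add_right, inner_smul_right, inner_p_sq, inner_self_eq_norm_sq_to_K]
    push_cast
    rfl
  rw [h2, Complex.norm_real] at h1
  have h3 := (le_abs_self _).trans h1
  have h4 : ‖toL2 φ‖ * (a * ‖toL2 φ‖) ≤
      ‖toL2 φ‖ * ‖toL2 (p hbar (p hbar φ)) + (a : ℂ) • toL2 φ‖ := by
    nlinarith [sq_nonneg ‖toL2 (p hbar φ)‖]
  exact le_of_mul_le_mul_left h4 hpos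

end Semiclassical

namespace Semiclassical

open scoped CompactlySupported BoundedContinuousFunction

/-! ### The spectral theorem -/
variable {𝓗 : Type*} [NormedAddCommGroup 𝓗] [InnerProductSpace ℂ 𝓗] [CompleteSpace 𝓗]
variable {X : Type*} [MetricSpace X]
variable (Φ : C(X, ℝ) →⋆ₐ[ℝ] (𝓗 →L[ℂ] 𝓗))

lemma inner_hom_left (f : C(X, ℝ)) (φ ψ : 𝓗) : inner ℂ (Φ f φ) ψ = inner ℂ φ (Φ f ψ) := by
  have h : IsSelfAdjoint (Φ f) := (IsSelfAdjoint.all f).map Φ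
  exact (ContinuousLinearMap.isSelfAdjoint_iff_isSymmetric.1 h) φ ψ

lemma inner_hom_hom (f g : C(X, ℝ)) (φ ψ : 𝓗) :
    inner ℂ (Φ f φ) (Φ g ψ) = inner ℂ φ (Φ (f * g) ψ) := by
  rw [inner_hom_left, map_mul]
  rfl

variable [CompactSpace X] [MeasurableSpace X] [BorelSpace X]

/-- A nonnegative `f` is the square of `√f`, so `f ↦ ⟪ψ, Φ f ψ⟫ = ‖Φ √f ψ‖²` is a positive
functional, and the Riesz–Markov–Kakutani theorem represents it. -/
lemma exists_vectorMeasure (ψ : 𝓗) : ∃ μ : Measure X, IsFiniteMeasure μ ∧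
    ∀ f : C(X, ℝ), inner ℂ ψ (Φ f ψ) = ((∫ x, f x ∂μ : ℝ) : ℂ) := by
  let L : C_c(X, ℝ) →ₗ[ℝ] ℝ :=
    { toFun := fun f => (inner ℂ ψ (Φ (f : C(X, ℝ)) ψ)).re
      map_add' := fun f g => by
        have : ((f + g : C_c(X, ℝ)) : C(X, ℝ)) = (f : C(X, ℝ)) + (g : C(X, ℝ)) := rfl
        rw [this, map_add, add_apply, inner_add_right, Complex.add_re]
      map_smul' := fun c f => by
        have : ((c • f : C_c(X, ℝ)) : C(X, ℝ)) = c • (f : C(X, ℝ)) := rfl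
        rw [this, map_smul, smul_apply, RCLike.real_smul_eq_coe_smul (K := ℂ) c, inner_smul_right]
        simp }
  have hpos : ∀ f, 0 ≤ f → 0 ≤ L f := fun f hf => by
    let g : C(X, ℝ) := ⟨fun x => Real.sqrt (f x), by fun_prop⟩
    have hg : (f : C(X, ℝ)) = g * g := by
      ext x
      exact (Real.mul_self_sqrt (hf x)).symm
    change 0 ≤ (inner ℂ ψ (Φ (f : C(X, ℝ)) ψ)).re
    rw [hg, ← inner_hom_hom]
    exact inner_self_nonneg (𝕜 := ℂ)
  refine ⟨RealRMK.rieszMeasure (PositiveLinearMap.mk₀ L hpos), inferInstance, fun f => ?_⟩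
  let f' : C_c(X, ℝ) := ⟨f, HasCompactSupport.of_compactSpace f⟩
  have h1 := RealRMK.integral_rieszMeasure (PositiveLinearMap.mk₀ L hpos) f'
  have h2 : (inner ℂ ψ (Φ f ψ)).im = 0 := by
    have := inner_hom_left Φ f ψ ψ
    rw [← inner_conj_symm] at this
    exact Complex.conj_eq_iff_im.1 this
  refine Complex.ext ?_ ?_
  · exact h1.symm
  · rw [h2]
    exact (Complex.ofReal_im _).symm

/-- The measure `μ` with `⟪ψ, Φ f ψ⟫ = ∫ f dμ` for continuous `f`. -/
def vectorMeasure (ψ : 𝓗) : Measure X := (exists_vectorMeasure Φ ψ).choose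

instance (ψ : 𝓗) : IsFiniteMeasure (vectorMeasure Φ ψ) := (exists_vectorMeasure Φ ψ).choose_spec.1

lemma inner_hom_self (ψ : 𝓗) (f : C(X, ℝ)) :
    inner ℂ ψ (Φ f ψ) = ((∫ x, f x ∂(vectorMeasure Φ ψ) : ℝ) : ℂ) :=
  (exists_vectorMeasure Φ ψ).choose_spec.2 f

lemma inner_hom_hom_self (ψ : 𝓗) (f g : C(X, ℝ)) :
    inner ℂ (Φ f ψ) (Φ g ψ) = ((inner ℝ (ContinuousMap.toLp 2 (vectorMeasure Φ ψ) ℝ f)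
      (ContinuousMap.toLp 2 (vectorMeasure Φ ψ) ℝ g) : ℝ) : ℂ) := by
  rw [inner_hom_hom, inner_hom_self, ContinuousMap.inner_toLp]
  simp [mul_comm]

/-- This isometry lets `f ↦ Φ f ψ` extend to all of `L²(μ_ψ)`, in particular to indicators. -/
lemma norm_hom_apply (ψ : 𝓗) (f : C(X, ℝ)) :
    ‖Φ f ψ‖ = ‖ContinuousMap.toLp 2 (vectorMeasure Φ ψ) ℝ f‖ := by
  have h := inner_hom_hom_self Φ ψ f f
  rw [real_inner_self_eq_norm_sq] at h
  have h2 : ‖Φ f ψ‖ ^ 2 = ‖ContinuousMap.toLp 2 (vectorMeasure Φ ψ) ℝ f‖ ^ 2 := by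
    rw [← inner_self_eq_norm_sq (𝕜 := ℂ), h]
    exact Complex.ofReal_re _
  exact (pow_left_inj₀ (norm_nonneg _) (norm_nonneg _) two_ne_zero).1 h2

/-- The map `f ↦ Φ f ψ` as a linear map. -/
def orbit (ψ : 𝓗) : C(X, ℝ) →ₗ[ℝ] 𝓗 where
  toFun f := Φ f ψ
  map_add' f g := by rw [map_add]; rfl
  map_smul' c f := by rw [map_smul]; rfl

/-- The extension of `f ↦ Φ f ψ` to `L²` of the vector measure. -/
def orbitLp (ψ : 𝓗) : Lp ℝ 2 (vectorMeasure Φ ψ) →L[ℝ] 𝓗 :=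
  (orbit Φ ψ).extendOfNorm (ContinuousMap.toLp 2 (vectorMeasure Φ ψ) ℝ : C(X, ℝ) →L[ℝ] _).toLinearMap

lemma denseRange_toLp (ψ : 𝓗) :
    DenseRange (ContinuousMap.toLp 2 (vectorMeasure Φ ψ) ℝ : C(X, ℝ) →L[ℝ] Lp ℝ 2 (vectorMeasure Φ ψ)) :=
  ContinuousMap.toLp_denseRange ℝ _ ℝ (by simp)

lemma orbitLp_toLp (ψ : 𝓗) (f : C(X, ℝ)) :
    orbitLp Φ ψ (ContinuousMap.toLp 2 (vectorMeasure Φ ψ) ℝ f) = Φ f ψ :=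
  LinearMap.extendOfNorm_eq (denseRange_toLp Φ ψ) ⟨1, fun f => by
    rw [one_mul]; exact (norm_hom_apply Φ ψ f).le⟩ f

lemma inner_orbitLp (ψ : 𝓗) (g h : Lp ℝ 2 (vectorMeasure Φ ψ)) :
    inner ℂ (orbitLp Φ ψ g) (orbitLp Φ ψ h) = ((inner ℝ g h : ℝ) : ℂ) := by
  refine (denseRange_toLp Φ ψ).induction_on₂ (p := fun g h => inner ℂ (orbitLp Φ ψ g) (orbitLp Φ ψ h) = ((inner ℝ g h : ℝ) : ℂ)) ?_ ?_ g h
  · exact isClosed_eq (by fun_prop) (Complex.continuous_ofReal.comp (by fun_prop))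
  · intro f g
    rw [orbitLp_toLp, orbitLp_toLp, inner_hom_hom_self]

lemma norm_orbitLp (ψ : 𝓗) (h : Lp ℝ 2 (vectorMeasure Φ ψ)) : ‖orbitLp Φ ψ h‖ = ‖h‖ := by
  have e := inner_orbitLp Φ ψ h h
  rw [real_inner_self_eq_norm_sq] at e
  have h2 : ‖orbitLp Φ ψ h‖ ^ 2 = ‖h‖ ^ 2 := by
    rw [← inner_self_eq_norm_sq (𝕜 := ℂ), e]
    exact Complex.ofReal_re _
  exact (pow_left_inj₀ (norm_nonneg _) (norm_nonneg _) two_ne_zero).1 h2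

/-- The isometry intertwines `Φ k` and multiplication by `k`. -/
lemma hom_orbitLp (ψ : 𝓗) (k : C(X, ℝ)) {h h' : Lp ℝ 2 (vectorMeasure Φ ψ)}
    (hh : h' =ᵐ[vectorMeasure Φ ψ] fun x => k x * h x) :
    Φ k (orbitLp Φ ψ h) = orbitLp Φ ψ h' := by
  rw [← sub_eq_zero, ← norm_le_zero_iff]
  refine le_of_forall_pos_le_add fun ε hε => ?_
  rw [zero_add]
  set δ := ε / (‖Φ k‖ + ‖k‖ + 1) with hδ
  have hδ0 : 0 < δ := by positivity
  obtain ⟨_, ⟨f, rfl⟩, hf⟩ := Metric.mem_closure_iff.1 (denseRange_toLp Φ ψ h) δ hδ0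
  rw [dist_eq_norm] at hf
  set J : C(X, ℝ) →L[ℝ] Lp ℝ 2 (vectorMeasure Φ ψ) := ContinuousMap.toLp 2 (vectorMeasure Φ ψ) ℝ
  -- For continuous `f` both sides of the intertwining relation are `Φ (k f) ψ`; only the
  -- approximation error of `h` by `f` remains.
  have e1 : Φ k (orbitLp Φ ψ h) - orbitLp Φ ψ h' =
      Φ k (orbitLp Φ ψ (h - J f)) + orbitLp Φ ψ (J (k * f) - h') := by
    rw [map_sub, map_sub, map_sub, orbitLp_toLp, orbitLp_toLp, map_mul]
    simp
  have e2 : ‖J (k * f) - h'‖ ≤ ‖k‖ * ‖h - J f‖ := by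
    refine Lp.norm_le_mul_norm_of_ae_le_mul ?_
    filter_upwards [Lp.coeFn_sub (J (k * f)) h', Lp.coeFn_sub h (J f), hh,
      ContinuousMap.coeFn_toLp (p := 2) (𝕜 := ℝ) (vectorMeasure Φ ψ) (k * f),
      ContinuousMap.coeFn_toLp (p := 2) (𝕜 := ℝ) (vectorMeasure Φ ψ) f] with x h1 h2 h3 h4 h5
    rw [h1, h2, Pi.sub_apply, Pi.sub_apply, h3, h4, h5, ContinuousMap.mul_apply, ← mul_sub,
      norm_mul, norm_sub_rev]
    gcongr
    exact k.norm_coe_le_norm x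
  rw [e1]
  calc _ ≤ ‖Φ k‖ * ‖h - J f‖ + ‖k‖ * ‖h - J f‖ := by
        refine (norm_add_le _ _).trans (add_le_add ?_ ?_)
        · refine ((Φ k).le_opNorm _).trans_eq ?_
          rw [norm_orbitLp]
        · rw [norm_orbitLp]
          exact e2
    _ ≤ (‖Φ k‖ + ‖k‖ + 1) * δ := by nlinarith [norm_nonneg (Φ k), norm_nonneg k, norm_nonneg (h - J f)]
    _ = ε := by rw [hδ]; field_simp

/-- The function `ψ ↦ Φ 1_B ψ`. -/
def specMap {B : Set X} (hB : MeasurableSet B) (ψ : 𝓗) : 𝓗 :=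
  orbitLp Φ ψ (indicatorConstLp 2 hB (measure_ne_top _ _) 1)

lemma inner_specMap_specMap {B C : Set X} (hB : MeasurableSet B) (hC : MeasurableSet C) (ψ : 𝓗) :
    inner ℂ (specMap Φ hB ψ) (specMap Φ hC ψ) = (((vectorMeasure Φ ψ).real (B ∩ C) : ℝ) : ℂ) := by
  rw [specMap, specMap, inner_orbitLp, L2.inner_indicatorConstLp_indicatorConstLp]
  simp

lemma specMap_univ (ψ : 𝓗) : specMap Φ MeasurableSet.univ ψ = ψ := by
  have h : indicatorConstLp 2 MeasurableSet.univ (measure_ne_top (vectorMeasure Φ ψ) _) (1 : ℝ) =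
      ContinuousMap.toLp 2 (vectorMeasure Φ ψ) ℝ (1 : C(X, ℝ)) := by
    refine Lp.ext ?_
    filter_upwards [ContinuousMap.coeFn_toLp (p := 2) (𝕜 := ℝ) (vectorMeasure Φ ψ) (1 : C(X, ℝ)),
      indicatorConstLp_coeFn (p := 2) (hs := MeasurableSet.univ)
        (hμs := measure_ne_top (vectorMeasure Φ ψ) _) (c := (1 : ℝ))] with x h1 h2
    rw [h1, h2]
    simp
  rw [specMap, h, orbitLp_toLp, map_one]
  rfl

lemma inner_specMap {B : Set X} (hB : MeasurableSet B) (ψ : 𝓗) :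
    inner ℂ ψ (specMap Φ hB ψ) = (((vectorMeasure Φ ψ).real B : ℝ) : ℂ) := by
  have h := inner_specMap_specMap Φ MeasurableSet.univ hB ψ
  rwa [specMap_univ, univ_inter] at h

/-- `Φ 1_B` is approximated by `Φ f`, with `f` continuous, on finitely many vectors at once. -/
lemma exists_norm_hom_sub_specMap_le {B : Set X} (hB : MeasurableSet B) (s : Finset 𝓗) {δ : ℝ}
    (hδ : 0 < δ) : ∃ f : C(X, ℝ), ∀ ψ ∈ s, ‖Φ f ψ - specMap Φ hB ψ‖ ≤ δ := by
  -- Approximating in `L²` of the sum of the vector measures controls all of them with a single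
  -- continuous function.
  have hmem : MemLp (B.indicator fun _ => (1 : ℝ)) 2 (∑ ψ ∈ s, vectorMeasure Φ ψ) :=
    memLp_indicator_const 2 hB 1 (.inr (measure_ne_top _ _))
  obtain ⟨g, hg, -⟩ := hmem.exists_boundedContinuous_eLpNorm_sub_le (by simp)
    (ε := ENNReal.ofReal δ) (by simpa using hδ)
  refine ⟨g.toContinuousMap, fun ψ hψ => ?_⟩
  rw [← orbitLp_toLp, specMap, ← map_sub, norm_orbitLp, norm_sub_rev, Lp.norm_def]
  refine ENNReal.toReal_le_of_le_ofReal hδ.le (le_trans ?_ hg)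
  refine le_trans (le_of_eq (eLpNorm_congr_ae ?_))
    (eLpNorm_mono_measure _ (Finset.single_le_sum (f := fun ψ => vectorMeasure Φ ψ)
      (fun _ _ => Measure.zero_le _) hψ))
  filter_upwards [ContinuousMap.coeFn_toLp (p := 2) (𝕜 := ℝ) (vectorMeasure Φ ψ) g.toContinuousMap,
    indicatorConstLp_coeFn (p := 2) (hs := hB)
      (hμs := measure_ne_top (vectorMeasure Φ ψ) _) (c := (1 : ℝ)),
    Lp.coeFn_sub (indicatorConstLp 2 hB (measure_ne_top (vectorMeasure Φ ψ) _) (1 : ℝ))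
      (ContinuousMap.toLp 2 (vectorMeasure Φ ψ) ℝ g.toContinuousMap)] with x h1 h2 h3
  rw [h3, Pi.sub_apply, h1, h2]
  rfl

/-- `specMap Φ hB ψ` is built in an `L²` space that depends on `ψ`, so linearity is not formal. It
is inherited from `Φ f` for one `f` approximating the indicator at all three vectors. -/
lemma specMap_add {B : Set X} (hB : MeasurableSet B) (φ ψ : 𝓗) :
    specMap Φ hB (φ + ψ) = specMap Φ hB φ + specMap Φ hB ψ := by
  classical
  rw [← sub_eq_zero, ← norm_le_zero_iff]
  refine le_of_forall_pos_le_add fun ε hε => ?_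
  obtain ⟨f, hf⟩ := exists_norm_hom_sub_specMap_le Φ hB {φ, ψ, φ + ψ} (δ := ε / 3) (by positivity)
  have h1 := hf φ (by simp)
  have h2 := hf ψ (by simp)
  have h3 := hf (φ + ψ) (by simp)
  have e : specMap Φ hB (φ + ψ) - (specMap Φ hB φ + specMap Φ hB ψ) =
      (Φ f φ - specMap Φ hB φ) + (Φ f ψ - specMap Φ hB ψ) -
        (Φ f (φ + ψ) - specMap Φ hB (φ + ψ)) := by
    rw [map_add (Φ f)]
    abel
  rw [e]
  refine (norm_sub_le _ _).trans ?_
  have := norm_add_le (Φ f φ - specMap Φ hB φ) (Φ f ψ - specMap Φ hB ψ)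
  linarith

lemma specMap_smul {B : Set X} (hB : MeasurableSet B) (c : ℂ) (ψ : 𝓗) :
    specMap Φ hB (c • ψ) = c • specMap Φ hB ψ := by
  classical
  rw [← sub_eq_zero, ← norm_le_zero_iff]
  refine le_of_forall_pos_le_add fun ε hε => ?_
  obtain ⟨f, hf⟩ := exists_norm_hom_sub_specMap_le Φ hB {ψ, c • ψ} (δ := ε / (‖c‖ + 1))
    (by positivity)
  have h1 := hf ψ (by simp)
  have h2 := hf (c • ψ) (by simp)
  have e : specMap Φ hB (c • ψ) - c • specMap Φ hB ψ =
      c • (Φ f ψ - specMap Φ hB ψ) - (Φ f (c • ψ) - specMap Φ hB (c • ψ)) := by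
    rw [map_smul (Φ f), smul_sub]
    abel
  rw [e, zero_add]
  calc _ ≤ ‖c‖ * (ε / (‖c‖ + 1)) + ε / (‖c‖ + 1) := by
        refine (norm_sub_le _ _).trans (add_le_add ?_ h2)
        rw [norm_smul]
        gcongr
    _ = ε := by field_simp

lemma norm_specMap_le {B : Set X} (hB : MeasurableSet B) (ψ : 𝓗) : ‖specMap Φ hB ψ‖ ≤ ‖ψ‖ := by
  have h : ∀ {C : Set X} (hC : MeasurableSet C),
      ‖specMap Φ hC ψ‖ ^ 2 = (vectorMeasure Φ ψ).real C := fun hC => by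
    rw [← inner_self_eq_norm_sq (𝕜 := ℂ), inner_specMap_specMap, inter_self]
    exact Complex.ofReal_re _
  have h1 := h MeasurableSet.univ
  rw [specMap_univ] at h1
  refine (pow_le_pow_iff_left₀ (norm_nonneg _) (norm_nonneg _) two_ne_zero).1 ?_
  rw [h hB, h1]
  exact measureReal_mono (subset_univ _)

/-- The operator `Φ 1_B`. -/
def specProj {B : Set X} (hB : MeasurableSet B) : 𝓗 →L[ℂ] 𝓗 :=
  LinearMap.mkContinuous
    { toFun := specMap Φ hB
      map_add' := specMap_add Φ hB
      map_smul' := specMap_smul Φ hB } 1 fun ψ => by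
    rw [one_mul]
    exact norm_specMap_le Φ hB ψ

lemma specProj_apply {B : Set X} (hB : MeasurableSet B) (ψ : 𝓗) :
    specProj Φ hB ψ = specMap Φ hB ψ := rfl

lemma isSelfAdjoint_specProj {B : Set X} (hB : MeasurableSet B) :
    IsSelfAdjoint (specProj Φ hB) := by
  rw [ContinuousLinearMap.isSelfAdjoint_iff_isSymmetric,
    LinearMap.isSymmetric_iff_inner_map_self_real]
  intro ψ
  change (starRingEnd ℂ) (inner ℂ (specMap Φ hB ψ) ψ) = inner ℂ (specMap Φ hB ψ) ψ
  rw [inner_conj_symm, ← inner_conj_symm (specMap Φ hB ψ), inner_specMap, Complex.conj_ofReal]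

lemma specProj_univ : specProj Φ MeasurableSet.univ = 1 := by
  ext ψ
  exact specMap_univ Φ ψ

lemma specProj_mul {B C : Set X} (hB : MeasurableSet B) (hC : MeasurableSet C) :
    specProj Φ hB * specProj Φ hC = specProj Φ (hB.inter hC) := by
  -- Over `ℂ` an operator is determined by its quadratic form; both forms at `ψ` equal `μ_ψ(B ∩ C)`.
  have h : ((specProj Φ hB * specProj Φ hC - specProj Φ (hB.inter hC) : 𝓗 →L[ℂ] 𝓗) :
      𝓗 →ₗ[ℂ] 𝓗) = 0 := by
    refine (inner_map_self_eq_zero _).1 fun ψ => ?_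
    have h1 := (ContinuousLinearMap.isSelfAdjoint_iff_isSymmetric.1 (isSelfAdjoint_specProj Φ hB))
      (specMap Φ hC ψ) ψ
    have h2 : inner ℂ (specMap Φ (hB.inter hC) ψ) ψ =
        (((vectorMeasure Φ ψ).real (B ∩ C) : ℝ) : ℂ) := by
      rw [← inner_conj_symm, inner_specMap, Complex.conj_ofReal]
    change inner ℂ (specProj Φ hB (specMap Φ hC ψ) - specMap Φ (hB.inter hC) ψ) ψ = 0
    rw [inner_sub_left, h2]
    change inner ℂ (specProj Φ hB (specMap Φ hC ψ)) ψ = _ at h1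
    rw [h1]
    change inner ℂ (specMap Φ hC ψ) (specMap Φ hB ψ) - _ = 0
    rw [inner_specMap_specMap, inter_comm, sub_self]
  ext ψ
  exact sub_eq_zero.1 (DFunLike.congr_fun h ψ)

lemma isStarProjection_specProj {B : Set X} (hB : MeasurableSet B) :
    IsStarProjection (specProj Φ hB) := by
  refine (isStarProjection_iff _).2 ⟨?_, isSelfAdjoint_specProj Φ hB⟩
  rw [IsIdempotentElem, specProj_mul]
  simp only [inter_self]

/-! ### The unbounded inverse of an injective `Φ k` in terms of vector measures -/

lemma ae_ne_zero_of_injective {k : C(X, ℝ)} (hk : Function.Injective (Φ k)) (ψ : 𝓗) :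
    ∀ᵐ x ∂(vectorMeasure Φ ψ), k x ≠ 0 := by
  have hB : MeasurableSet (k ⁻¹' {0}) := k.continuous.measurable (measurableSet_singleton 0)
  have h0 : Φ k (specMap Φ hB ψ) = orbitLp Φ ψ 0 := by
    refine hom_orbitLp Φ ψ k ?_
    filter_upwards [Lp.coeFn_zero ℝ 2 (vectorMeasure Φ ψ),
      indicatorConstLp_coeFn (p := 2) (hs := hB)
        (hμs := measure_ne_top (vectorMeasure Φ ψ) _) (c := (1 : ℝ))] with x h1 h2
    rw [h1, h2]
    by_cases hx : k x = 0
    · simp [hx]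
    · rw [indicator_of_notMem (by simpa using hx), mul_zero]
      rfl
  rw [map_zero, map_eq_zero_iff _ hk] at h0
  have h1 := inner_specMap_specMap Φ hB hB ψ
  rw [h0, inner_zero_left, inter_self, eq_comm, Complex.ofReal_eq_zero,
    measureReal_eq_zero_iff] at h1
  refine measure_mono_null (fun x hx => ?_) h1
  simpa using hx

/-- Moving `Φ k` across the inner product gives `⟪Φ k χ, Φ f (Φ k χ)⟫ = ⟪χ, Φ (k² f) χ⟫`. -/
lemma vectorMeasure_hom (k : C(X, ℝ)) (χ : 𝓗) :
    vectorMeasure Φ (Φ k χ) = (vectorMeasure Φ χ).withDensity fun x => ENNReal.ofReal (k x ^ 2) := by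
  have hm : Measurable fun x => ENNReal.ofReal (k x ^ 2) := by fun_prop
  have hint : Integrable (fun x => k x ^ 2) (vectorMeasure Φ χ) :=
    Continuous.integrable_of_hasCompactSupport (by fun_prop) (HasCompactSupport.of_compactSpace _)
  have := isFiniteMeasure_withDensity_ofReal hint.2
  refine ext_of_forall_integral_eq_of_IsFiniteMeasure fun f => ?_
  rw [integral_withDensity_eq_integral_toReal_smul hm (.of_forall fun _ => ENNReal.ofReal_lt_top)]
  have h1 := inner_hom_self Φ (Φ k χ) f.toContinuousMap
  have h2 := inner_hom_self Φ χ (k * (f.toContinuousMap * k))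
  have h3 : inner ℂ (Φ k χ) (Φ f.toContinuousMap (Φ k χ)) =
      inner ℂ χ (Φ (k * (f.toContinuousMap * k)) χ) := by
    rw [← inner_hom_hom, map_mul]
    rfl
  rw [h1, h2, Complex.ofReal_inj] at h3
  refine h3.trans (integral_congr_ae (.of_forall fun x => ?_))
  simp only [ContinuousMap.mul_apply, ENNReal.toReal_ofReal (sq_nonneg (k x)), smul_eq_mul]
  change k x * (f x * k x) = _
  ring

/-- The density `k²` cancels `k⁻²`, and the convention `0⁻¹ = 0` handles the zeros of `k`. With its
converse `mem_range_hom_of_memLp_inv`, this describes the range of `Φ k`, that is, the domain of its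
inverse. -/
lemma memLp_inv_hom (k : C(X, ℝ)) (χ : 𝓗) :
    MemLp (fun x => (k x)⁻¹) 2 (vectorMeasure Φ (Φ k χ)) := by
  have hm : Measurable fun x => ENNReal.ofReal (k x ^ 2) := by fun_prop
  have hm' : Measurable fun x => (k x)⁻¹ := k.continuous.measurable.inv
  rw [memLp_two_iff_integrable_sq hm'.aestronglyMeasurable, vectorMeasure_hom,
    integrable_withDensity_iff_integrable_smul' hm (.of_forall fun _ => ENNReal.ofReal_lt_top)]
  refine Integrable.of_bound (by fun_prop) 1 (.of_forall fun x => ?_)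
  rw [ENNReal.toReal_ofReal (sq_nonneg (k x)), smul_eq_mul, ← mul_pow, norm_pow]
  by_cases hx : k x = 0
  · simp [hx]
  · simp [mul_inv_cancel₀ hx]

lemma integral_inv_hom (k : C(X, ℝ)) (χ : 𝓗) :
    ((∫ x, (k x)⁻¹ ∂(vectorMeasure Φ (Φ k χ)) : ℝ) : ℂ) = inner ℂ χ (Φ k χ) := by
  have hm : Measurable fun x => ENNReal.ofReal (k x ^ 2) := by fun_prop
  rw [inner_hom_self, vectorMeasure_hom,
    integral_withDensity_eq_integral_toReal_smul hm (.of_forall fun _ => ENNReal.ofReal_lt_top)]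
  congr 1
  refine integral_congr_ae (.of_forall fun x => ?_)
  simp only [ENNReal.toReal_ofReal (sq_nonneg (k x)), smul_eq_mul]
  by_cases hx : k x = 0
  · simp [hx]
  · field_simp

lemma mem_range_hom_of_memLp_inv {k : C(X, ℝ)} (hk : Function.Injective (Φ k)) {ψ : 𝓗}
    (h : MemLp (fun x => (k x)⁻¹) 2 (vectorMeasure Φ ψ)) : ψ ∈ range (Φ k) := by
  refine ⟨orbitLp Φ ψ (h.toLp _), ?_⟩
  rw [hom_orbitLp Φ ψ k (h' := ContinuousMap.toLp 2 (vectorMeasure Φ ψ) ℝ (1 : C(X, ℝ))),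
    orbitLp_toLp, map_one]
  · rfl
  · filter_upwards [ContinuousMap.coeFn_toLp (p := 2) (𝕜 := ℝ) (vectorMeasure Φ ψ) (1 : C(X, ℝ)),
      h.coeFn_toLp, ae_ne_zero_of_injective Φ hk ψ] with x h1 h2 h3
    rw [h1, h2, mul_inv_cancel₀ h3]
    rfl

open Classical in
/-- The spectral theorem for an operator `T` such that `(T + a)⁻¹` is bounded and self-adjoint for
some real `a`. -/
theorem exists_isSpectralMeasure_of_inverse {T : 𝓗 →ₗ.[ℂ] 𝓗} {R : 𝓗 →L[ℂ] 𝓗}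
    (hR : IsSelfAdjoint R) (hinj : Function.Injective R) (a : ℝ)
    (hmem : ∀ ψ, ψ ∈ T.domain ↔ ψ ∈ range R)
    (hinv : ∀ χ (h : R χ ∈ T.domain), T ⟨R χ, h⟩ = χ - (a : ℂ) • R χ) :
    ∃ E, IsSpectralMeasure T E := by
  set Φ : C(spectrum ℝ R, ℝ) →⋆ₐ[ℝ] (𝓗 →L[ℂ] 𝓗) := cfcHom hR
  set k : C(spectrum ℝ R, ℝ) := (ContinuousMap.id ℝ).restrict (spectrum ℝ R)
  have hk : Φ k = R := cfcHom_id hR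
  have hkinj : Function.Injective (Φ k) := by rwa [hk]
  -- The point `s` in the spectrum of `R = (T + a)⁻¹` corresponds to `s⁻¹ - a` for `T`. The default
  -- value at `s = 0` is harmless: injectivity of `R` makes `{0}` null for every vector measure.
  set τ : spectrum ℝ R → ℝ := fun x => (k x)⁻¹ - a with hτdef
  have hτ : Measurable τ := k.continuous.measurable.inv.sub_const a
  set E : Set ℝ → 𝓗 →L[ℂ] 𝓗 := fun B =>
    if hB : MeasurableSet B then specProj Φ (hτ hB) else 0
  have hE : ∀ {B} (hB : MeasurableSet B), E B = specProj Φ (hτ hB) := fun hB => dif_pos hB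
  refine ⟨E, ⟨fun B hB => ?_, ?_, fun B C hB hC => ?_, fun ψ => ?_⟩⟩
  · rw [hE hB]
    exact isStarProjection_specProj Φ _
  · rw [hE MeasurableSet.univ]
    exact specProj_univ Φ
  · rw [hE hB, hE hC, hE (hB.inter hC), specProj_mul]
    rfl
  have hLp : MemLp (fun x => (k x)⁻¹) 2 (vectorMeasure Φ ψ) ↔
      Integrable (fun t : ℝ => t ^ 2) ((vectorMeasure Φ ψ).map τ) := by
    rw [integrable_map_measure (by fun_prop) hτ.aemeasurable]
    change _ ↔ Integrable (fun x => τ x ^ 2) _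
    rw [← memLp_two_iff_integrable_sq hτ.aestronglyMeasurable]
    refine ⟨fun h => h.sub (memLp_const a), fun h => ?_⟩
    have := h.add (memLp_const a)
    refine this.congr_norm (by fun_prop) (.of_forall fun x => ?_)
    simp [hτdef]
  refine ⟨(vectorMeasure Φ ψ).map τ, inferInstance, fun B hB => ?_, ?_, fun h => ?_⟩
  · rw [hE hB, specProj_apply, inner_specMap, map_measureReal_apply hτ hB]
  · rw [hmem, ← hLp]
    refine ⟨?_, fun h => hk ▸ mem_range_hom_of_memLp_inv Φ hkinj h⟩
    rintro ⟨χ, rfl⟩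
    have := memLp_inv_hom Φ k χ
    rwa [hk] at this
  · obtain ⟨χ, rfl⟩ := (hmem ψ).1 h
    -- The identity to match is `⟪Rχ, T Rχ⟫ = ⟪χ, Rχ⟫ - a ‖Rχ‖²`, whose two terms are the integrals
    -- of `k⁻¹` and of `a`.
    have h1 := integral_inv_hom Φ k χ
    have h2 := memLp_inv_hom Φ k χ
    have h3 := inner_hom_self Φ (R χ) 1
    rw [hk] at h1 h2
    rw [map_one] at h3
    change inner ℂ (R χ) (R χ) = _ at h3
    have h4 : inner ℂ (R χ) χ = inner ℂ χ (R χ) :=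
      ContinuousLinearMap.isSelfAdjoint_iff_isSymmetric.1 hR χ χ
    rw [hinv, inner_sub_right, inner_smul_right, h3, h4, ← h1,
      integral_map hτ.aemeasurable (by fun_prop), hτdef,
      integral_sub (h2.integrable one_le_two) (integrable_const a)]
    simp
    ring

end Semiclassical

namespace ReggeWheeler

/-! ### The Regge–Wheeler potential -/

variable {M : ℝ}

lemma radius_pos (hM : 0 < M) (x : ℝ) : 0 < radius M x := by
  have h : 2 * M < radius M x := radius_mem hM x
  linarith

lemma radius_hasDerivAt (hM : 0 < M) (x : ℝ) :
    HasDerivAt (radius M) (1 - 2 * M / radius M x) x := by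
  have hr : 2 * M < radius M x := radius_mem hM x
  have hr0 := radius_pos hM x
  have hd : DifferentiableAt ℝ (radius M) x :=
    (radius_contDiff hM).contDiffAt.differentiableAt (by simp)
  have hcomp := (tortoise_hasDerivAt hM (radius_mem hM x)).comp x hd.hasDerivAt
  have hid : (tortoise M ∘ radius M) = id := funext fun y => tortoise_radius hM y
  rw [hid] at hcomp
  have h1 := hcomp.unique (hasDerivAt_id x)
  have h2 : 1 + 2 * M * (1 / (2 * M) / (radius M x / (2 * M) - 1)) =
      radius M x / (radius M x - 2 * M) := by
    have : radius M x - 2 * M ≠ 0 := by linarith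
    have h3 : radius M x / (2 * M) - 1 = (radius M x - 2 * M) / (2 * M) := by field_simp
    rw [h3]
    field_simp
    ring
  rw [h2] at h1
  have h3 : deriv (radius M) x = 1 - 2 * M / radius M x := by
    have : radius M x - 2 * M ≠ 0 := by linarith
    field_simp at h1 ⊢
    linarith
  rw [← h3]
  exact hd.hasDerivAt

/-- The numerator of `dV/dr`, up to the factor `r⁵`. -/
def derivNumerator (M σ L r : ℝ) : ℝ :=
  -2 * L * r ^ 2 + 6 * M * (L - σ) * r + 16 * M ^ 2 * σ

lemma potential_hasDerivAt (hM : 0 < M) (σ : ℝ) (ℓ : ℕ) (x : ℝ) :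
    HasDerivAt (potential M σ ℓ) ((1 - 2 * M / radius M x) *
      (derivNumerator M σ ((ℓ : ℝ) * (ℓ + 1)) (radius M x) / radius M x ^ 5)) x := by
  have hr := radius_hasDerivAt hM x
  have hne := (radius_pos hM x).ne'
  have hF : HasDerivAt (fun y => 2 * M / radius M y) _ x :=
    (hasDerivAt_const x (2 * M)).div hr hne
  have h1 : HasDerivAt (fun y => (ℓ : ℝ) * (ℓ + 1) / radius M y ^ 2) _ x :=
    (hasDerivAt_const x ((ℓ : ℝ) * (ℓ + 1))).div (hr.pow 2) (pow_ne_zero 2 hne)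
  have h2 : HasDerivAt (fun y => 2 * M * σ / radius M y ^ 3) _ x :=
    (hasDerivAt_const x (2 * M * σ)).div (hr.pow 3) (pow_ne_zero 3 hne)
  have h := (hF.const_sub 1).mul (h1.add h2)
  refine h.congr_deriv ?_
  simp only [derivNumerator, Pi.add_apply]
  field_simp
  ring

lemma radius_strictMono (hM : 0 < M) : StrictMono (radius M) := by
  intro x y hxy
  by_contra! h
  have h1 := (tortoise_strictMonoOn hM).monotoneOn (radius_mem hM y) (radius_mem hM x) h
  rw [tortoise_radius hM, tortoise_radius hM] at h1
  linarith

/-- The tortoise coordinate expands distances. -/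
lemma radius_sub_le (hM : 0 < M) {x y : ℝ} (h : x ≤ y) : radius M y - radius M x ≤ y - x := by
  have h2M : (0 : ℝ) < 2 * M := by positivity
  have hxy := (radius_strictMono hM).monotone h
  have h1 : radius M x / (2 * M) - 1 ≤ radius M y / (2 * M) - 1 := by
    have := div_le_div_of_nonneg_right hxy h2M.le
    linarith
  have h2 := Real.log_le_log (sub_pos_of_mem hM (radius_mem hM x)) h1
  have h3 := mul_le_mul_of_nonneg_left h2 h2M.le
  have e1 := tortoise_radius hM x
  have e2 := tortoise_radius hM y
  unfold tortoise at e1 e2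
  linarith

/-- `(x - y)` and `r(x) - r(y)` have the same sign and the former is larger. -/
lemma sq_radius_sub_le (hM : 0 < M) (x y : ℝ) :
    (radius M x - radius M y) ^ 2 ≤ (x - y) * (radius M x - radius M y) := by
  rcases le_total x y with h | h
  · have h1 := radius_sub_le hM h
    have h2 := (radius_strictMono hM).monotone h
    nlinarith
  · have h1 := radius_sub_le hM h
    have h2 := (radius_strictMono hM).monotone h
    nlinarith

/-- `(1 - 2M/r) |x|` grows at most linearly in `r`. -/
lemma abs_mul_le (hM : 0 < M) (x : ℝ) :
    (1 - 2 * M / radius M x) * |x| ≤ 2 * radius M x := by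
  have hr : 2 * M < radius M x := radius_mem hM x
  have hr0 := radius_pos hM x
  have hx := tortoise_radius hM x
  have hu := sub_pos_of_mem hM (radius_mem hM x)
  set r := radius M x
  set u := r / (2 * M) - 1 with hu_def
  have hru : r = 2 * M * (u + 1) := by
    rw [hu_def]
    field_simp
    ring
  -- The term `u⁻¹` is affordable near the horizon because `1 - 2M/r = u/(u+1)` vanishes there to
  -- first order.
  have hlog : |Real.log u| ≤ u + u⁻¹ := by
    have h1 := Real.log_le_sub_one_of_pos hu
    have h2 := Real.log_le_sub_one_of_pos (inv_pos.2 hu)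
    rw [Real.log_inv] at h2
    have h3 := inv_pos.2 hu
    rw [abs_le]
    constructor <;> linarith
  have hF : 1 - 2 * M / r = u / (u + 1) := by
    rw [hru]
    field_simp
    ring
  have habs : |x| ≤ r + 2 * M * (u + u⁻¹) := by
    rw [← hx]
    unfold tortoise
    refine (abs_add_le _ _).trans ?_
    rw [abs_of_pos hr0, abs_mul, abs_of_pos (by positivity : (0 : ℝ) < 2 * M)]
    gcongr
  have hF0 : 0 ≤ 1 - 2 * M / r := by rw [hF]; positivity
  refine (mul_le_mul_of_nonneg_left habs hF0).trans ?_
  rw [hF, hru]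
  have e : u / (u + 1) * (2 * M * (u + 1) + 2 * M * (u + u⁻¹)) =
      2 * M * (u * (u + 1) + (u ^ 2 + 1)) / (u + 1) := by
    field_simp
  rw [e, div_le_iff₀ (by positivity)]
  nlinarith [mul_pos hM hu, mul_pos hM (mul_pos hu hu)]

lemma derivNumerator_eq_zero_of_isMaxOn (hM : 0 < M) {σ : ℝ} {ℓ : ℕ} {x : ℝ}
    (h : IsMaxOn (potential M σ ℓ) univ x) :
    derivNumerator M σ ((ℓ : ℝ) * (ℓ + 1)) (radius M x) = 0 := by
  have h1 := (h.isLocalMax Filter.univ_mem).hasDerivAt_eq_zero (potential_hasDerivAt hM σ ℓ x)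
  have hr : 2 * M < radius M x := radius_mem hM x
  have hr0 := radius_pos hM x
  have hF : 1 - 2 * M / radius M x ≠ 0 := by
    have : 2 * M / radius M x < 1 := (div_lt_one hr0).2 hr
    linarith
  have h2 := (mul_eq_zero.1 h1).resolve_left hF
  exact (div_eq_zero_iff.1 h2).resolve_right (pow_ne_zero 5 hr0.ne')

/-- For large angular momentum the critical radius is close to `3M`. -/
lemma abs_sub_three_mul_le (hM : 0 < M) {σ L r : ℝ} (hr : 2 * M < r) (hL : 0 < L)
    (hσ : 112 * |σ| ≤ L) (h : derivNumerator M σ L r = 0) : |r - 3 * M| ≤ M / 16 := by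
  have hr0 : 0 < r := by linarith
  have e : 2 * L * r * (r - 3 * M) = σ * (16 * M ^ 2 - 6 * M * r) := by
    unfold derivNumerator at h
    linarith
  have h1 : |16 * M ^ 2 - 6 * M * r| ≤ 14 * M * r := by
    rw [abs_le]
    constructor <;> nlinarith
  have h2 : 2 * L * r * |r - 3 * M| ≤ |σ| * (14 * M * r) := by
    have := congrArg abs e
    rw [abs_mul, abs_mul σ, abs_of_pos (by positivity : 0 < 2 * L * r)] at this
    rw [this]
    gcongr
  -- Here `112 = 14 · 8`: then `14 |σ| M r ≤ L M r / 8 = 2 L r (M / 16)`.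
  have h3 : 2 * L * r * |r - 3 * M| ≤ 2 * L * r * (M / 16) := by
    have := mul_le_mul_of_nonneg_right hσ (by positivity : 0 ≤ M * r)
    nlinarith
  exact le_of_mul_le_mul_left h3 (by positivity)

/-- Factorization of the derivative of the potential at the critical radius. -/
lemma mul_sq_le_neg_derivNumerator (hM : 0 < M) {σ L r r₀ t : ℝ} (hr : 2 * M < r)
    (hL : 0 < L) (hσ : 112 * |σ| ≤ L) (h0 : derivNumerator M σ L r₀ = 0)
    (hr₀ : |r₀ - 3 * M| ≤ M / 16) (ht : (r - r₀) ^ 2 ≤ t * (r - r₀)) :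
    L * r * (r - r₀) ^ 2 ≤ -(t * derivNumerator M σ L r) := by
  have e : derivNumerator M σ L r =
      -((r - r₀) * (2 * L * (r + r₀) - 6 * M * (L - σ))) := by
    have : derivNumerator M σ L r = derivNumerator M σ L r - derivNumerator M σ L r₀ := by
      rw [h0, sub_zero]
    rw [this]
    unfold derivNumerator
    ring
  -- Apart from the root `r₀`, the quadratic has a factor bounded below by `L r`, since `r > 2M`,
  -- `r₀ ≥ 47M/16` and `|σ| ≤ L/112`.
  have hs : L * r ≤ 2 * L * (r + r₀) - 6 * M * (L - σ) := by
    have h1 := (abs_le.1 hr₀).1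
    have h2 := neg_abs_le σ
    have h3 := mul_le_mul_of_nonneg_left h1 hL.le
    have h4 := mul_lt_mul_of_pos_left hr hL
    have h5 := mul_le_mul_of_nonneg_left h2 hM.le
    have h6 := mul_le_mul_of_nonneg_left hσ hM.le
    have h7 := mul_pos hM hL
    linarith
  rw [e]
  have hs0 : 0 ≤ 2 * L * (r + r₀) - 6 * M * (L - σ) :=
    (by have : 0 < r := by linarith
        positivity : 0 ≤ L * r).trans hs
  calc L * r * (r - r₀) ^ 2 ≤ (2 * L * (r + r₀) - 6 * M * (L - σ)) * (r - r₀) ^ 2 := by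
        gcongr
    _ ≤ (2 * L * (r + r₀) - 6 * M * (L - σ)) * (t * (r - r₀)) := by gcongr
    _ = _ := by ring

/-- The pointwise inequality behind the estimate, in the variable `r`. -/
lemma sq_le_combination (hM : 0 < M) {r r₀ : ℝ} (hr : 2 * M < r) (hr₀ : |r₀ - 3 * M| ≤ M / 16) :
    r ^ 2 ≤ 6 * (r ^ 2 - 2 * M * r - 2 * (r - r₀) * (r - 3 * M)) + 600 * (r - r₀) ^ 2 := by
  obtain ⟨h1, h2⟩ := abs_le.1 hr₀
  have hcross : -(r - r₀) ^ 2 - M ^ 2 / 256 ≤ -2 * (r - r₀) * (r₀ - 3 * M) := by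
    have : (r₀ - 3 * M) ^ 2 ≤ (M / 16) ^ 2 := sq_le_sq' h1 h2
    nlinarith [sq_nonneg (r - r₀ - (r₀ - 3 * M))]
  have hexp : -2 * (r - r₀) * (r - 3 * M) =
      -2 * (r - r₀) ^ 2 + -2 * (r - r₀) * (r₀ - 3 * M) := by ring
  -- For `r ≥ 5M/2` one has `6(r² - 2Mr) ≥ 6r²/5`, whose surplus over `r²` absorbs the `M²/256`
  -- error. For smaller `r` the point is at least `7M/16` from `r₀`, and the term `600 (r - r₀)²`
  -- suffices.
  rcases le_total (5 / 2 * M) r with h | h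
  · nlinarith [sq_nonneg (r - r₀), mul_nonneg hM.le (sub_nonneg.2 h)]
  · have h3 : 7 / 16 * M ≤ r₀ - r := by linarith
    have h4 : (7 / 16 * M) ^ 2 ≤ (r₀ - r) ^ 2 := by gcongr
    nlinarith [mul_pos hM (sub_pos.2 hr)]

end ReggeWheeler

namespace Semiclassical

open Filter Topology

/-! ### Closed realizations -/

lemma toL2_mem_domain (T : Module.End ℂ TestFn) (φ : TestFn) : toL2 φ ∈ (onTestFn T).domain :=
  ⟨φ, rfl⟩

lemma onTestFn_apply (T : Module.End ℂ TestFn) (φ : TestFn) :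
    onTestFn T ⟨toL2 φ, toL2_mem_domain T φ⟩ = toL2 (T φ) := by
  have h : (LinearEquiv.ofInjective toL2 toL2_injective).symm
      (⟨toL2 φ, φ, rfl⟩ : LinearMap.range toL2) = φ := by
    rw [LinearEquiv.symm_apply_eq]
    rfl
  exact congrArg (fun χ => toL2 (T χ)) h

lemma dense_domain_onTestFn (T : Module.End ℂ TestFn) :
    Dense ((onTestFn T).domain : Set L2) := by
  have h : ((onTestFn T).domain : Set L2) = range toL2 := LinearMap.coe_range toL2
  rw [h]
  exact denseRange_toL2

lemma isFormalAdjoint_onTestFn {T : Module.End ℂ TestFn}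
    (h : ∀ φ ψ, inner ℂ (toL2 (T φ)) (toL2 ψ) = inner ℂ (toL2 φ) (toL2 (T ψ))) :
    (onTestFn T).IsFormalAdjoint (onTestFn T) := by
  rintro ⟨_, φ, rfl⟩ ⟨_, ψ, rfl⟩
  have h1 := onTestFn_apply T φ
  have h2 := onTestFn_apply T ψ
  rw [h1, h2]
  exact h φ ψ

lemma mem_graph_realization_iff {T : Module.End ℂ TestFn}
    (h : ∀ φ ψ, inner ℂ (toL2 (T φ)) (toL2 ψ) = inner ℂ (toL2 φ) (toL2 (T ψ))) {x y : L2} :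
    (x, y) ∈ (realization T).graph ↔ ∃ φ : ℕ → TestFn,
      Tendsto (fun n => toL2 (φ n)) atTop (𝓝 x) ∧
        Tendsto (fun n => toL2 (T (φ n))) atTop (𝓝 y) := by
  have hcl := (isFormalAdjoint_onTestFn h).isClosable (dense_domain_onTestFn T)
  rw [realization, hcl.mem_graph_closure_iff]
  constructor
  · rintro ⟨u, hu1, hu2⟩
    choose φ hφ using fun n => (u n).2
    refine ⟨φ, ?_, ?_⟩
    · simp_rw [hφ]
      exact hu1
    · refine hu2.congr fun n => ?_
      rw [← onTestFn_apply]
      congr 1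
      exact Subtype.ext (hφ n).symm
  · rintro ⟨φ, h1, h2⟩
    refine ⟨fun n => ⟨toL2 (φ n), toL2_mem_domain T _⟩, h1, ?_⟩
    simp_rw [onTestFn_apply]
    exact h2

lemma schrodinger_apply (hbar : ℝ) {v : ℝ → ℝ} (hv : ContDiff ℝ ∞ v) (φ : TestFn) :
    schrodinger hbar v hv φ = p hbar (p hbar φ) + mulOp v hv φ := by
  rw [schrodinger, sq]
  rfl

/-- For a potential bounded by `b`, the operator `p² + v + b + 1` is bounded below by one and has
dense range on the test functions. -/
lemma norm_le_and_denseRange_schrodinger_add (hbar : ℝ) {v : ℝ → ℝ} (hv : ContDiff ℝ ∞ v)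
    {b : ℝ} (hb : ∀ x, |v x| ≤ b) :
    (∀ x : (onTestFn (schrodinger hbar v hv)).domain,
      1 * ‖(x : L2)‖ ≤ ‖onTestFn (schrodinger hbar v hv) x + ((b + 1 : ℝ) : ℂ) • (x : L2)‖) ∧
    DenseRange fun x : (onTestFn (schrodinger hbar v hv)).domain =>
      onTestFn (schrodinger hbar v hv) x + ((b + 1 : ℝ) : ℂ) • (x : L2) := by
  have hb0 : 0 ≤ b := (abs_nonneg _).trans (hb 0)
  -- With this shift `v` has relative bound `b/a < 1` with respect to `p² + a`, and `a - b = 1` is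
  -- the lower bound.
  set a : ℝ := b + 1 with ha
  have ha0 : 0 < a := by positivity
  set A : TestFn →ₗ[ℂ] L2 := toL2 ∘ₗ (p hbar ^ 2 + (a : ℂ) • 1) with hA
  set B : TestFn →ₗ[ℂ] L2 := toL2 ∘ₗ mulOp v hv with hB
  have hAφ : ∀ φ, A φ = toL2 (p hbar (p hbar φ)) + (a : ℂ) • toL2 φ := fun φ => by
    rw [← map_smul, ← map_add, hA, sq]
    rfl
  have hAlow : ∀ φ, a * ‖toL2 φ‖ ≤ ‖A φ‖ := fun φ => by
    rw [hAφ]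
    exact mul_norm_le_norm_p_sq_add hbar φ
  have hBle : ∀ φ, ‖B φ‖ ≤ b * ‖toL2 φ‖ := fun φ => norm_toL2_mulOp_le hv hb φ
  have hS : ∀ φ, toL2 (schrodinger hbar v hv φ) + (a : ℂ) • toL2 φ = A φ + B φ := fun φ => by
    rw [hAφ, schrodinger_apply, map_add]
    change _ = _ + toL2 (mulOp v hv φ)
    abel
  have hdense : DenseRange (A + B) := by
    refine denseRange_add_of_norm_le (q := b / a) (by positivity)
      ((div_lt_one ha0).2 (by linarith)) (fun φ => ?_) (denseRange_p_sq_add ha0)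
    refine (hBle φ).trans ?_
    rw [div_mul_eq_mul_div, le_div_iff₀ ha0]
    have := mul_le_mul_of_nonneg_left (hAlow φ) hb0
    linarith
  constructor
  · rintro ⟨_, φ, rfl⟩
    have h1 := onTestFn_apply (schrodinger hbar v hv) φ
    rw [h1, hS, one_mul]
    have h2 := norm_sub_norm_le (A φ) (-B φ)
    rw [sub_neg_eq_add, norm_neg] at h2
    have h3 := hAlow φ
    have h4 := hBle φ
    simp only
    linarith
  · refine hdense.mono ?_
    rintro _ ⟨φ, rfl⟩
    refine ⟨⟨toL2 φ, toL2_mem_domain _ φ⟩, ?_⟩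
    simp only [onTestFn_apply, hS]
    rfl

/-- A Schrödinger operator with bounded smooth potential is essentially self-adjoint on the test
functions. -/
theorem isSelfAdjoint_realization_schrodinger (hbar : ℝ) {v : ℝ → ℝ} (hv : ContDiff ℝ ∞ v)
    {b : ℝ} (hb : ∀ x, |v x| ≤ b) : IsSelfAdjoint (realization (schrodinger hbar v hv)) := by
  obtain ⟨hlow, hr⟩ := norm_le_and_denseRange_schrodinger_add hbar hv hb
  have hs := isFormalAdjoint_onTestFn (inner_schrodinger_left hbar hv)
  have hd := dense_domain_onTestFn (schrodinger hbar v hv)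
  have hcl := hs.isClosable hd
  exact (hs.closure hcl).isSelfAdjoint_of_surjective (hd.mono (LinearPMap.le_closure _).1)
    (hcl.exists_closure_add_eq one_pos hlow hr)

/-- The bounded inverse of `H + b + 1` feeds the spectral theorem. Existence ensures that
`spectralProjection` is a value of a spectral measure rather than its default `0`. -/
theorem exists_isSpectralMeasure_realization_schrodinger (hbar : ℝ) {v : ℝ → ℝ}
    (hv : ContDiff ℝ ∞ v) {b : ℝ} (hb : ∀ x, |v x| ≤ b) :
    ∃ E, IsSpectralMeasure (realization (schrodinger hbar v hv)) E := by
  obtain ⟨hlow, hr⟩ := norm_le_and_denseRange_schrodinger_add hbar hv hb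
  have hs := isFormalAdjoint_onTestFn (inner_schrodinger_left hbar hv)
  have hcl := hs.isClosable (dense_domain_onTestFn _)
  obtain ⟨R, hR, hinj, hmem, hinv⟩ := (hs.closure hcl).exists_inverse one_pos
    (hcl.mul_norm_le_norm_closure_add hlow) (hcl.exists_closure_add_eq one_pos hlow hr)
  exact exists_isSpectralMeasure_of_inverse hR hinj _ hmem hinv

/-- Symmetry makes the commutator closable, so that its realization has a graph described by limits
of test functions. -/
lemma inner_scaledCommutator_left {hbar : ℝ} (hh : hbar ≠ 0) {v v' : ℝ → ℝ} (hv : ContDiff ℝ ∞ v)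
    (hv' : ContDiff ℝ ∞ v') (hd : ∀ x, HasDerivAt v (v' x) x) (φ ψ : TestFn) :
    inner ℂ (toL2 (scaledCommutator hbar (schrodinger hbar v hv) (dilation hbar) φ)) (toL2 ψ) =
      inner ℂ (toL2 φ)
        (toL2 (scaledCommutator hbar (schrodinger hbar v hv) (dilation hbar) ψ)) := by
  rw [scaledCommutator_schrodinger_dilation hh hv hv' hd,
    scaledCommutator_schrodinger_dilation hh hv hv' hd]
  simp only [map_sub, map_smul, inner_sub_left, inner_sub_right, inner_smul_left,
    inner_smul_right, inner_p_left, inner_mulOp_left, map_ofNat]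

/-- If `v` and `x v'` are bounded then the domain of `p² + v` is contained in the domain of its
commutator with the generator of dilations, and inequalities between the quadratic forms of the two
operators extend from the test functions. -/
theorem mem_domain_commutator_of_mem_domain {hbar : ℝ} (hh : hbar ≠ 0) {v v' : ℝ → ℝ} (hv : ContDiff ℝ ∞ v)
    (hv' : ContDiff ℝ ∞ v') (hd : ∀ x, HasDerivAt v (v' x) x)
    {b : ℝ} (hb : ∀ x, |2 * v x + x * v' x| ≤ b)
    {s K : ℝ} (hform : ∀ φ : TestFn,
      (s : ℂ) * inner ℂ (toL2 φ) (toL2 (schrodinger hbar v hv φ)) ≤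
        (K : ℂ) * inner ℂ (toL2 φ)
          (toL2 (scaledCommutator hbar (schrodinger hbar v hv) (dilation hbar) φ)))
    (ψ : L2) (hψ : ψ ∈ (realization (schrodinger hbar v hv)).domain) :
    ∃ h : ψ ∈ (realization
        (scaledCommutator hbar (schrodinger hbar v hv) (dilation hbar))).domain,
      (s : ℂ) * inner ℂ ψ (realization (schrodinger hbar v hv) ⟨ψ, hψ⟩) ≤
        (K : ℂ) * inner ℂ ψ (realization
          (scaledCommutator hbar (schrodinger hbar v hv) (dilation hbar)) ⟨ψ, h⟩) := by
  set C := scaledCommutator hbar (schrodinger hbar v hv) (dilation hbar) with hC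
  have hw : ContDiff ℝ ∞ fun x => 2 * v x + x * v' x :=
    (contDiff_const.mul hv).add (contDiff_id.mul hv')
  have hCφ : ∀ φ, toL2 (C φ) = (2 : ℂ) • toL2 (schrodinger hbar v hv φ) -
      toL2 (mulOp _ hw φ) := fun φ => by
    -- Writing the commutator as `2H - (2v + xv')` leaves a bounded multiplication, so graph
    -- convergence for `H` implies graph convergence for the commutator.
    have e : C φ = (2 : ℂ) • schrodinger hbar v hv φ - mulOp _ hw φ := by
      rw [hC, scaledCommutator_schrodinger_dilation hh hv hv' hd, schrodinger_apply]
      ext x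
      simp only [Submodule.coe_sub, Submodule.coe_smul, Submodule.coe_add, Pi.sub_apply,
        Pi.smul_apply, Pi.add_apply, smul_eq_mul, mulOp_apply]
      push_cast
      ring
    rw [e, map_sub, map_smul]
  obtain ⟨φ, h1, h2⟩ := (mem_graph_realization_iff (inner_schrodinger_left hbar hv)).1
    ((realization (schrodinger hbar v hv)).mem_graph ⟨ψ, hψ⟩)
  have hcau : CauchySeq fun n => toL2 (mulOp _ hw (φ n)) := by
    have hb0 : 0 ≤ b := (abs_nonneg _).trans (hb 0)
    rw [Metric.cauchySeq_iff']
    intro δ hδ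
    obtain ⟨N, hN⟩ := Metric.cauchySeq_iff'.1 h1.cauchySeq (δ / (b + 1)) (by positivity)
    refine ⟨N, fun n hn => ?_⟩
    have h3 := hN n hn
    rw [lt_div_iff₀ (by positivity)] at h3
    rw [dist_eq_norm, ← map_sub, ← map_sub]
    refine lt_of_le_of_lt (norm_toL2_mulOp_le hw hb _) ?_
    rw [map_sub, ← dist_eq_norm]
    nlinarith [dist_nonneg (x := toL2 (φ n)) (y := toL2 (φ N))]
  obtain ⟨z, hz⟩ := cauchySeq_tendsto_of_complete hcau
  have h3 : Tendsto (fun n => toL2 (C (φ n))) atTop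
      (𝓝 ((2 : ℂ) • realization (schrodinger hbar v hv) ⟨ψ, hψ⟩ - z)) := by
    simp_rw [hCφ]
    exact (h2.const_smul _).sub hz
  have hmem := (mem_graph_realization_iff
    (inner_scaledCommutator_left hh hv hv' hd)).2 ⟨φ, h1, h3⟩
  obtain ⟨⟨y, hy⟩, hy1, hy2⟩ := (LinearPMap.mem_graph_iff _).1 hmem
  simp only at hy1 hy2
  subst hy1
  refine ⟨hy, ?_⟩
  rw [hy2]
  exact le_of_tendsto_of_tendsto' ((h1.inner h2).const_mul _) ((h1.inner h3).const_mul _)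
    fun n => hform (φ n)

/-- The form inequality for test functions. -/
lemma form_le_form_commutator {hbar : ℝ} (hpos : 0 < hbar) {v v' : ℝ → ℝ} (hv : ContDiff ℝ ∞ v)
    (hv' : ContDiff ℝ ∞ v') (hd : ∀ x, HasDerivAt v (v' x) x)
    (h1 : hbar ≤ 1) {f f' : ℝ → ℝ}
    (hf : ContDiff ℝ ∞ f) (hf' : ContDiff ℝ ∞ f') (hdf : ∀ x, HasDerivAt f (f' x) x)
    {κ D K : ℝ} (hκ : 0 ≤ κ) (hD : 1 ≤ D) (hK : κ + D ≤ K) (hfW : ∀ x, f x ^ 2 ≤ -(x * v' x))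
    (hvW : ∀ x, v x ≤ κ * f' x + D * -(x * v' x)) (φ : TestFn) :
    (hbar : ℂ) * inner ℂ (toL2 φ) (toL2 (schrodinger hbar v hv φ)) ≤
      (K : ℂ) * inner ℂ (toL2 φ)
        (toL2 (scaledCommutator hbar (schrodinger hbar v hv) (dilation hbar) φ)) := by
  have hh : hbar ≠ 0 := hpos.ne'
  have hW0 : ∀ x, 0 ≤ -(x * v' x) := fun x => (sq_nonneg _).trans (hfW x)
  have hxv' : ContDiff ℝ ∞ fun x => x * v' x := contDiff_id.mul hv'
  have iW := integrable_mul_norm_sq hxv'.neg.continuous φ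
  have if' := integrable_mul_norm_sq hf'.continuous φ
  have if2 := integrable_mul_norm_sq (hf.pow 2).continuous φ
  have iv := integrable_mul_norm_sq hv.continuous φ
  set P := ‖toL2 (p hbar φ)‖ ^ 2 with hP
  set W := ∫ x, -(x * v' x) * ‖φ.1 x‖ ^ 2 with hWdef
  have hWn : ∫ x, x * v' x * ‖φ.1 x‖ ^ 2 = -W := by
    rw [hWdef, ← integral_neg]
    refine integral_congr_ae (.of_forall fun x => ?_)
    simp only
    ring
  have hP0 : 0 ≤ P := by positivity
  have hWnn : 0 ≤ W := integral_nonneg fun x => mul_nonneg (hW0 x) (sq_nonneg _)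
  have e1 : inner ℂ (toL2 φ) (toL2 (schrodinger hbar v hv φ)) =
      ((P + ∫ x, v x * ‖φ.1 x‖ ^ 2 : ℝ) : ℂ) := by
    rw [schrodinger_apply, map_add, inner_add_right, inner_p_sq, inner_toL2_mulOp]
    push_cast [hP]
    rfl
  have e2 : inner ℂ (toL2 φ)
      (toL2 (scaledCommutator hbar (schrodinger hbar v hv) (dilation hbar) φ)) =
      ((2 * P + W : ℝ) : ℂ) := by
    rw [scaledCommutator_schrodinger_dilation hh hv hv' hd, map_sub, map_smul, inner_sub_right,
      inner_smul_right, inner_p_sq, inner_toL2_mulOp, hWn]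
    push_cast [hP]
    ring
  have k1 := integral_deriv_mul_norm_sq_le hbar hf hf' hdf φ
  have k2 : ∫ x, f x ^ 2 * ‖φ.1 x‖ ^ 2 ≤ W :=
    integral_mono if2 iW fun x => mul_le_mul_of_nonneg_right (hfW x) (sq_nonneg _)
  have k3 : ∫ x, v x * ‖φ.1 x‖ ^ 2 ≤ κ * (∫ x, f' x * ‖φ.1 x‖ ^ 2) + D * W := by
    rw [hWdef, ← integral_const_mul, ← integral_const_mul,
      ← integral_add (if'.const_mul _) (iW.const_mul _)]
    refine integral_mono iv ((if'.const_mul _).add (iW.const_mul _)) fun x => ?_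
    have := mul_le_mul_of_nonneg_right (hvW x) (sq_nonneg ‖φ.1 x‖)
    simp only
    linarith
  rw [e1, e2]
  -- The chain is `ħ∫v|φ|² ≤ κ ħ∫f'|φ|² + ħ D W ≤ κ(P + W) + D W`, while `ħ P ≤ D P`; the total is
  -- at most `(κ + D)(P + W)`.
  have : hbar * (P + ∫ x, v x * ‖φ.1 x‖ ^ 2) ≤ K * (2 * P + W) := by
    refine le_trans ?_ (mul_le_mul_of_nonneg_right hK (by positivity : 0 ≤ 2 * P + W))
    have k4 := mul_le_mul_of_nonneg_left k3 hpos.le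
    have k5 := mul_le_mul_of_nonneg_left (k1.trans (add_le_add_right k2 P)) hκ
    have k6 : hbar * (D * W) ≤ D * W := by
      have : 0 ≤ D * W := by positivity
      nlinarith
    have k7 : hbar * P ≤ P := by nlinarith
    have k8 : P ≤ D * P := by nlinarith
    have k9 : 0 ≤ κ * P := by positivity
    nlinarith
  exact_mod_cast this

end Semiclassical

/-! ### Pointwise bounds on the rescaled potential and the multiplier -/

namespace ReggeWheeler

open Semiclassical

variable {M : ℝ}

lemma one_sub_div_radius_mem (hM : 0 < M) (x : ℝ) :
    0 < 1 - 2 * M / radius M x ∧ 1 - 2 * M / radius M x ≤ 1 := by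
  have hr : 2 * M < radius M x := radius_mem hM x
  have hr0 := radius_pos hM x
  have h1 : 2 * M / radius M x < 1 := (div_lt_one hr0).2 hr
  have h2 : 0 ≤ 2 * M / radius M x := by positivity
  constructor <;> linarith

lemma semiPotential_hasDerivAt (hM : 0 < M) (σ : ℝ) (ℓ : ℕ) (hbar xmax x : ℝ) :
    HasDerivAt (semiPotential M σ ℓ hbar xmax)
      (hbar ^ 2 * ((1 - 2 * M / radius M (x + xmax)) *
        (derivNumerator M σ ((ℓ : ℝ) * (ℓ + 1)) (radius M (x + xmax)) /
          radius M (x + xmax) ^ 5))) x :=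
  ((potential_hasDerivAt hM σ ℓ (x + xmax)).comp_add_const x xmax).const_mul _

/-- The Regge–Wheeler potential is bounded. -/
lemma abs_potential_le (hM : 0 < M) (σ : ℝ) (ℓ : ℕ) (x : ℝ) :
    |potential M σ ℓ x| ≤ ((ℓ : ℝ) * (ℓ + 1) + |σ|) / (4 * M ^ 2) := by
  have hr : 2 * M < radius M x := radius_mem hM x
  have hr0 := radius_pos hM x
  obtain ⟨hF0, hF1⟩ := one_sub_div_radius_mem hM x
  unfold potential
  set r := radius M x
  set L : ℝ := (ℓ : ℝ) * (ℓ + 1)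
  have hL : 0 ≤ L := by positivity
  have h1 : |L / r ^ 2 + 2 * M * σ / r ^ 3| ≤ (L + |σ|) / r ^ 2 := by
    refine (abs_add_le _ _).trans ?_
    rw [abs_of_nonneg (by positivity : 0 ≤ L / r ^ 2), abs_div, abs_mul,
      abs_of_pos (by positivity : 0 < 2 * M), abs_of_pos (by positivity : 0 < r ^ 3), add_div]
    gcongr _ + ?_
    rw [div_le_div_iff₀ (by positivity) (by positivity)]
    have : 2 * M * |σ| * r ^ 2 ≤ r * |σ| * r ^ 2 := by gcongr
    linarith
  have h2 : (L + |σ|) / r ^ 2 ≤ (L + |σ|) / (4 * M ^ 2) := by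
    gcongr
    nlinarith
  rw [abs_mul, abs_of_pos hF0]
  calc _ ≤ 1 * ((L + |σ|) / (4 * M ^ 2)) := by
        gcongr
        exact h1.trans h2
    _ = _ := one_mul _

/-- The function `x V'(x)` is bounded. -/
lemma exists_abs_mul_deriv_le (hM : 0 < M) (σ : ℝ) (ℓ : ℕ) (hbar xmax : ℝ) :
    ∃ b, ∀ x, |x * deriv (semiPotential M σ ℓ hbar xmax) x| ≤ b := by
  obtain ⟨L, hLdef⟩ : ∃ L : ℝ, L = (ℓ : ℝ) * (ℓ + 1) := ⟨_, rfl⟩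
  have hL : 0 ≤ L := by rw [hLdef]; positivity
  set Q : ℝ := 2 * L + 3 * (L + |σ|) + 4 * |σ| with hQ
  refine ⟨hbar ^ 2 * ((2 + |xmax| / (2 * M)) * (Q / (4 * M ^ 2))), fun x => ?_⟩
  rw [(semiPotential_hasDerivAt hM σ ℓ hbar xmax x).deriv, ← hLdef]
  have hr : 2 * M < radius M (x + xmax) := radius_mem hM _
  have hr0 := radius_pos hM (x + xmax)
  obtain ⟨hF0, hF1⟩ := one_sub_div_radius_mem hM (x + xmax)
  have hx := abs_mul_le hM (x + xmax)
  set r := radius M (x + xmax)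
  have hQ0 : 0 ≤ Q := by positivity
  have hq : |derivNumerator M σ L r| ≤ Q * r ^ 2 := by
    unfold derivNumerator
    have h1 : |L - σ| ≤ L + |σ| := (abs_sub _ _).trans (by rw [abs_of_nonneg hL])
    refine (abs_add_three _ _ _).trans ?_
    rw [abs_mul, abs_mul, abs_mul, abs_mul, abs_mul, abs_mul, abs_mul, abs_of_nonneg hL,
      abs_of_pos hM, abs_of_pos hr0, abs_of_pos (by positivity : 0 < r ^ 2),
      abs_of_pos (by positivity : 0 < M ^ 2)]
    norm_num
    have h2 : 6 * M * |L - σ| * r ≤ 3 * (L + |σ|) * r ^ 2 := by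
      have : 2 * M * |L - σ| * r ≤ r * (L + |σ|) * r := by gcongr
      nlinarith
    have h3 : 16 * M ^ 2 * |σ| ≤ 4 * |σ| * r ^ 2 := by
      have : (2 * M) ^ 2 * |σ| ≤ r ^ 2 * |σ| := by gcongr
      nlinarith
    rw [hQ]
    linarith
  -- This linear growth in `r` is compensated by the `1/r` decay of the remaining factor of `V'`.
  have hxF : (1 - 2 * M / r) * |x| ≤ (2 + |xmax| / (2 * M)) * r := by
    have h1 : |x| ≤ |x + xmax| + |xmax| := by
      have := abs_sub (x + xmax) xmax
      rwa [add_sub_cancel_right] at this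
    have h2 : |xmax| ≤ |xmax| / (2 * M) * r := by
      rw [div_mul_eq_mul_div, le_div_iff₀ (by positivity)]
      gcongr
    calc (1 - 2 * M / r) * |x| ≤ (1 - 2 * M / r) * (|x + xmax| + |xmax|) := by gcongr
      _ ≤ 2 * r + 1 * |xmax| := by
          rw [mul_add]
          gcongr
      _ ≤ _ := by linarith
  have hqr : |derivNumerator M σ L r / r ^ 5| ≤ Q / (4 * M ^ 2) / r := by
    rw [abs_div, abs_of_pos (by positivity : 0 < r ^ 5), div_div,
      div_le_div_iff₀ (by positivity) (by positivity)]
    have h1 : (2 * M) ^ 2 ≤ r ^ 2 := by gcongr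
    calc |derivNumerator M σ L r| * (4 * M ^ 2 * r) ≤ (Q * r ^ 2) * (r ^ 2 * r) := by
          have : 4 * M ^ 2 ≤ r ^ 2 := by linarith
          gcongr
      _ = _ := by ring
  calc _ = hbar ^ 2 * (((1 - 2 * M / r) * |x|) * |derivNumerator M σ L r / r ^ 5|) := by
        rw [abs_mul, abs_mul, abs_mul, abs_of_pos hF0, abs_of_nonneg (sq_nonneg hbar)]
        ring
    _ ≤ hbar ^ 2 * (((2 + |xmax| / (2 * M)) * r) * (Q / (4 * M ^ 2) / r)) := by gcongr
    _ = _ := by field_simp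

/-- A multiplier whose derivative, together with `-x V'`, controls the potential. -/
def escape (M xmax x : ℝ) : ℝ :=
  M * ((1 - 2 * M / radius M (x + xmax)) *
    ((radius M (x + xmax) - radius M xmax) / radius M (x + xmax) ^ 2))

lemma escape_contDiff (hM : 0 < M) (xmax : ℝ) : ContDiff ℝ ∞ (escape M xmax) := by
  have hr : ContDiff ℝ ∞ fun x => radius M (x + xmax) :=
    (radius_contDiff hM).comp (contDiff_id.add contDiff_const)
  have h : ∀ x, radius M (x + xmax) ≠ 0 := fun x => (radius_pos hM _).ne'
  exact contDiff_const.mul ((contDiff_const.sub (contDiff_const.div hr h)).mul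
    ((hr.sub contDiff_const).div (hr.pow 2) fun x => pow_ne_zero 2 (h x)))

lemma escape_hasDerivAt (hM : 0 < M) (xmax x : ℝ) :
    HasDerivAt (escape M xmax) (M * ((1 - 2 * M / radius M (x + xmax)) *
      ((radius M (x + xmax) ^ 2 - 2 * M * radius M (x + xmax) -
        2 * (radius M (x + xmax) - radius M xmax) * (radius M (x + xmax) - 3 * M)) /
          radius M (x + xmax) ^ 4))) x := by
  have hr := (radius_hasDerivAt hM (x + xmax)).comp_add_const x xmax
  have hne := (radius_pos hM (x + xmax)).ne'
  have h1 : HasDerivAt (fun y => 2 * M / radius M (y + xmax)) _ x :=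
    (hasDerivAt_const x (2 * M)).div hr hne
  have h2 : HasDerivAt (fun y => (radius M (y + xmax) - radius M xmax) / radius M (y + xmax) ^ 2)
      _ x := (hr.sub_const (radius M xmax)).div (hr.pow 2) (pow_ne_zero 2 hne)
  refine (((h1.const_sub 1).mul h2).const_mul M).congr_deriv ?_
  field_simp
  ring

/-- If `ħ` is small then the angular momentum is large. -/
lemma angular_large (hM : 0 < M) {σ : ℝ} {ℓ : ℕ} {hbar xmax : ℝ} (hpos : 0 < hbar)
    (hle : hbar ≤ M / (6 * (1 + |σ|))) (h1 : hbar ^ 2 * potential M σ ℓ xmax = 1) :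
    0 < (ℓ : ℝ) * (ℓ + 1) ∧ 112 * |σ| ≤ (ℓ : ℝ) * (ℓ + 1) := by
  have hV := (le_abs_self _).trans (abs_potential_le hM σ ℓ xmax)
  set L : ℝ := (ℓ : ℝ) * (ℓ + 1)
  have hL : 0 ≤ L := by positivity
  have hs := abs_nonneg σ
  have h2 : (6 * (1 + |σ|) * hbar) ^ 2 ≤ M ^ 2 := by
    rw [le_div_iff₀ (by positivity)] at hle
    have : 6 * (1 + |σ|) * hbar ≤ M := by linarith
    gcongr
  have h3 : 4 * M ^ 2 ≤ hbar ^ 2 * (L + |σ|) := by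
    rw [le_div_iff₀ (by positivity)] at hV
    have := mul_le_mul_of_nonneg_left hV (sq_nonneg hbar)
    nlinarith
  have h4 : hbar ^ 2 * (144 * (1 + |σ|) ^ 2) ≤ hbar ^ 2 * (L + |σ|) := by nlinarith
  -- The constant is `4 · 6²`, with `4M²` from the bound on the potential and `6` from the bound on
  -- `ħ`. It exceeds what `112 |σ| ≤ L` needs and also gives `L > 0`.
  have h5 : 144 * (1 + |σ|) ^ 2 ≤ L + |σ| := le_of_mul_le_mul_left h4 (by positivity)
  constructor <;> nlinarith

/-- Since `r > 2M`, the `σ` term is at most half the angular term, so `V` is comparable to the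
potential with `σ = 0`. -/
lemma potential_bounds (hM : 0 < M) {σ : ℝ} {ℓ : ℕ} (hσ : 112 * |σ| ≤ (ℓ : ℝ) * (ℓ + 1)) (x : ℝ) :
    (1 - 2 * M / radius M x) * ((ℓ : ℝ) * (ℓ + 1) / (2 * radius M x ^ 2)) ≤ potential M σ ℓ x ∧
    potential M σ ℓ x ≤ (1 - 2 * M / radius M x) * (2 * ((ℓ : ℝ) * (ℓ + 1)) / radius M x ^ 2) := by
  have hr : 2 * M < radius M x := radius_mem hM x
  have hr0 := radius_pos hM x
  obtain ⟨hF0, hF1⟩ := one_sub_div_radius_mem hM x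
  unfold potential
  set r := radius M x
  set L : ℝ := (ℓ : ℝ) * (ℓ + 1)
  have hL : 0 ≤ L := by positivity
  have hs := abs_nonneg σ
  have h0 : |2 * M * σ| ≤ L / 2 * r := by
    rw [abs_mul, abs_of_pos (by positivity : 0 < 2 * M)]
    calc 2 * M * |σ| ≤ r * (L / 2) := by gcongr; linarith
      _ = _ := mul_comm _ _
  obtain ⟨h1, h2⟩ := abs_le.1 h0
  have e : 2 * M * σ / r ^ 3 = (2 * M * σ / r) / r ^ 2 := by
    field_simp
  have h3 : -(L / 2) ≤ 2 * M * σ / r := by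
    rw [le_div_iff₀ hr0]
    linarith
  have h4 : 2 * M * σ / r ≤ L / 2 := by
    rw [div_le_iff₀ hr0]
    linarith
  rw [e, ← add_div]
  constructor
  · rw [← div_div]
    have : L / 2 ≤ L + 2 * M * σ / r := by linarith
    gcongr
  · have : L + 2 * M * σ / r ≤ 2 * L := by linarith
    gcongr

/-- The size of the coupling constant `ħ² ℓ(ℓ+1)`. -/
lemma coupling_bounds (hM : 0 < M) {σ : ℝ} {ℓ : ℕ} {hbar xmax : ℝ}
    (hσ : 112 * |σ| ≤ (ℓ : ℝ) * (ℓ + 1)) (hr₀ : |radius M xmax - 3 * M| ≤ M / 16)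
    (h1 : hbar ^ 2 * potential M σ ℓ xmax = 1) :
    2 * M ^ 2 ≤ hbar ^ 2 * ((ℓ : ℝ) * (ℓ + 1)) ∧
      hbar ^ 2 * ((ℓ : ℝ) * (ℓ + 1)) ≤ 128 * M ^ 2 := by
  obtain ⟨hV1, hV2⟩ := potential_bounds hM hσ xmax
  have hr : 2 * M < radius M xmax := radius_mem hM xmax
  have hr0 := radius_pos hM xmax
  obtain ⟨hF0, hF1⟩ := one_sub_div_radius_mem hM xmax
  obtain ⟨ha, hb⟩ := abs_le.1 hr₀
  -- Near `3M` one has `8M/3 ≤ r₀ ≤ 4M`. Hence `1/4 ≤ 1 - 2M/r₀ ≤ 1`, and the condition `V(0) = 1`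
  -- bounds `ħ² L` on both sides; `128 = 4 · 2 · 4²`.
  have hF : 1 / 4 ≤ 1 - 2 * M / radius M xmax := by
    have : 2 * M / radius M xmax ≤ 3 / 4 := by
      rw [div_le_iff₀ hr0]
      linarith
    linarith
  set r := radius M xmax
  set L : ℝ := (ℓ : ℝ) * (ℓ + 1)
  have hL : 0 ≤ L := by positivity
  have h2 := mul_le_mul_of_nonneg_left hV1 (sq_nonneg hbar)
  have h3 := mul_le_mul_of_nonneg_left hV2 (sq_nonneg hbar)
  rw [h1] at h2 h3
  constructor
  · have h4 : (1 - 2 * M / r) * (2 * L / r ^ 2) ≤ 1 * (2 * L / (2 * M) ^ 2) := by gcongr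
    have h5 := h3.trans (mul_le_mul_of_nonneg_left h4 (sq_nonneg hbar))
    have e : hbar ^ 2 * (1 * (2 * L / (2 * M) ^ 2)) = hbar ^ 2 * L / (2 * M ^ 2) := by
      field_simp
    rw [e, le_div_iff₀ (by positivity)] at h5
    linarith
  · have h4 : 1 / 4 * (L / (2 * (4 * M) ^ 2)) ≤ (1 - 2 * M / r) * (L / (2 * r ^ 2)) := by
      gcongr
      linarith
    have h5 := (mul_le_mul_of_nonneg_left h4 (sq_nonneg hbar)).trans h2
    have e : hbar ^ 2 * (1 / 4 * (L / (2 * (4 * M) ^ 2))) = hbar ^ 2 * L / (128 * M ^ 2) := by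
      field_simp
      ring
    rw [e, div_le_iff₀ (by positivity)] at h5
    linarith

/-- Lower bound for `-x V'(x)`. -/
lemma le_neg_mul_deriv (hM : 0 < M) {σ : ℝ} {ℓ : ℕ} {hbar xmax : ℝ}
    (hL : 0 < (ℓ : ℝ) * (ℓ + 1)) (hσ : 112 * |σ| ≤ (ℓ : ℝ) * (ℓ + 1))
    (hmax : IsMaxOn (potential M σ ℓ) univ xmax)
    (hr₀ : |radius M xmax - 3 * M| ≤ M / 16) (x : ℝ) :
    hbar ^ 2 * ((ℓ : ℝ) * (ℓ + 1)) * ((1 - 2 * M / radius M (x + xmax)) *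
      ((radius M (x + xmax) - radius M xmax) ^ 2 / radius M (x + xmax) ^ 4)) ≤
      -(x * deriv (semiPotential M σ ℓ hbar xmax) x) := by
  rw [(semiPotential_hasDerivAt hM σ ℓ hbar xmax x).deriv]
  have hr : 2 * M < radius M (x + xmax) := radius_mem hM _
  have hr0 := radius_pos hM (x + xmax)
  obtain ⟨hF0, hF1⟩ := one_sub_div_radius_mem hM (x + xmax)
  have ht := sq_radius_sub_le hM (x + xmax) xmax
  rw [add_sub_cancel_right] at ht
  have h := mul_sq_le_neg_derivNumerator hM hr hL hσ
    (derivNumerator_eq_zero_of_isMaxOn hM hmax) hr₀ ht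
  set r := radius M (x + xmax)
  set r₀ := radius M xmax
  set L : ℝ := (ℓ : ℝ) * (ℓ + 1)
  have e1 : hbar ^ 2 * L * ((1 - 2 * M / r) * ((r - r₀) ^ 2 / r ^ 4)) =
      hbar ^ 2 * (1 - 2 * M / r) / r ^ 5 * (L * r * (r - r₀) ^ 2) := by
    field_simp
  have e2 : -(x * (hbar ^ 2 * ((1 - 2 * M / r) * (derivNumerator M σ L r / r ^ 5)))) =
      hbar ^ 2 * (1 - 2 * M / r) / r ^ 5 * -(x * derivNumerator M σ L r) := by
    ring
  rw [e1, e2]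
  gcongr

/-- The square of the multiplier is bounded by `-x V'`. -/
lemma escape_sq_le (hM : 0 < M) {σ : ℝ} {ℓ : ℕ} {hbar xmax : ℝ}
    (hL : 0 < (ℓ : ℝ) * (ℓ + 1)) (hσ : 112 * |σ| ≤ (ℓ : ℝ) * (ℓ + 1))
    (hmax : IsMaxOn (potential M σ ℓ) univ xmax)
    (hr₀ : |radius M xmax - 3 * M| ≤ M / 16)
    (hlam : 2 * M ^ 2 ≤ hbar ^ 2 * ((ℓ : ℝ) * (ℓ + 1))) (x : ℝ) :
    escape M xmax x ^ 2 ≤ -(x * deriv (semiPotential M σ ℓ hbar xmax) x) := by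
  refine le_trans ?_ (le_neg_mul_deriv hM hL hσ hmax hr₀ x)
  have hr0 := radius_pos hM (x + xmax)
  obtain ⟨hF0, hF1⟩ := one_sub_div_radius_mem hM (x + xmax)
  unfold escape
  set r := radius M (x + xmax)
  set r₀ := radius M xmax
  have e : (M * ((1 - 2 * M / r) * ((r - r₀) / r ^ 2))) ^ 2 =
      M ^ 2 * (1 - 2 * M / r) * ((1 - 2 * M / r) * ((r - r₀) ^ 2 / r ^ 4)) := by
    ring
  rw [e]
  have hz : 0 ≤ (1 - 2 * M / r) * ((r - r₀) ^ 2 / r ^ 4) := by positivity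
  -- What remains is `M² (1 - 2M/r) ≤ ħ² L`, where the normalizing factor `M` of the multiplier is
  -- used.
  refine mul_le_mul_of_nonneg_right ?_ hz
  have : M ^ 2 * (1 - 2 * M / r) ≤ M ^ 2 * 1 := by gcongr
  linarith [sq_nonneg M]

/-- The potential is controlled by the derivative of the multiplier and by `-x V'`. -/
lemma semiPotential_le (hM : 0 < M) {σ : ℝ} {ℓ : ℕ} {hbar xmax : ℝ}
    (hL : 0 < (ℓ : ℝ) * (ℓ + 1)) (hσ : 112 * |σ| ≤ (ℓ : ℝ) * (ℓ + 1))
    (hmax : IsMaxOn (potential M σ ℓ) univ xmax)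
    (hr₀ : |radius M xmax - 3 * M| ≤ M / 16) (x : ℝ) :
    semiPotential M σ ℓ hbar xmax x ≤
      12 * (hbar ^ 2 * ((ℓ : ℝ) * (ℓ + 1))) / M * deriv (escape M xmax) x +
        1200 * -(x * deriv (semiPotential M σ ℓ hbar xmax) x) := by
  have hW := le_neg_mul_deriv (hbar := hbar) hM hL hσ hmax hr₀ x
  have hV := mul_le_mul_of_nonneg_left (potential_bounds hM hσ (x + xmax)).2 (sq_nonneg hbar)
  have hr : 2 * M < radius M (x + xmax) := radius_mem hM _
  have hr0 := radius_pos hM (x + xmax)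
  obtain ⟨hF0, hF1⟩ := one_sub_div_radius_mem hM (x + xmax)
  have hc := sq_le_combination hM hr hr₀
  rw [(escape_hasDerivAt hM xmax x).deriv]
  change hbar ^ 2 * potential M σ ℓ (x + xmax) ≤ _
  set r := radius M (x + xmax)
  set r₀ := radius M xmax
  set L : ℝ := (ℓ : ℝ) * (ℓ + 1)
  set S := r ^ 2 - 2 * M * r - 2 * (r - r₀) * (r - 3 * M)
  -- Scaling the inequality in `r` by `2ħ²L(1 - 2M/r)/r⁴` turns its left side into the upper bound
  -- for `V` and the coefficients `6`, `600` into `12`, `1200`.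
  have h1 := mul_le_mul_of_nonneg_left hc
    (by positivity : 0 ≤ 2 * (hbar ^ 2 * L) * (1 - 2 * M / r) / r ^ 4)
  have e1 : 2 * (hbar ^ 2 * L) * (1 - 2 * M / r) / r ^ 4 * r ^ 2 =
      hbar ^ 2 * ((1 - 2 * M / r) * (2 * L / r ^ 2)) := by
    field_simp
  have e2 : 2 * (hbar ^ 2 * L) * (1 - 2 * M / r) / r ^ 4 * (6 * S + 600 * (r - r₀) ^ 2) =
      12 * (hbar ^ 2 * L) / M * (M * ((1 - 2 * M / r) * (S / r ^ 4))) +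
        1200 * (hbar ^ 2 * L * ((1 - 2 * M / r) * ((r - r₀) ^ 2 / r ^ 4))) := by
    field_simp
    ring
  rw [e1, e2] at h1
  linarith

end ReggeWheeler

end

/-! ### The Mourre estimate -/

open Semiclassical ReggeWheeler in
theorem mainTheorem4 (M : ℝ) (hM : 0 < M) (σ : ℝ) (ε : ℝ) (hε : 0 < ε) :
    ∃ hbar₀ : ℝ, 0 < hbar₀ ∧ ∃ c₀ : ℝ, 0 < c₀ ∧
      ∀ (ℓ : ℕ) (hbar xmax : ℝ), 0 < hbar → hbar ≤ hbar₀ →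
        IsMaxOn (potential M σ ℓ) univ xmax → hbar ^ 2 * potential M σ ℓ xmax = 1 →
        IsSelfAdjoint (hamiltonian hM σ ℓ hbar xmax) ∧
        ∀ ψ : L2, ∃ h : energyProjection hM σ ℓ hbar xmax (Icc (ε / 2) 100) ψ ∈
            (commutatorHA hM σ ℓ hbar xmax).domain,
          ((c₀ * hbar : ℝ) : ℂ) *
              inner ℂ ψ (energyProjection hM σ ℓ hbar xmax (Icc (ε / 2) 100) ψ) ≤
            inner ℂ (energyProjection hM σ ℓ hbar xmax (Icc (ε / 2) 100) ψ)
              (commutatorHA hM σ ℓ hbar xmax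
                ⟨energyProjection hM σ ℓ hbar xmax (Icc (ε / 2) 100) ψ, h⟩) := by
  -- This dominates `κ + D`: `κ = 12 ħ² L / M ≤ 12 · 128 M` and `D = 1200`.
  set K : ℝ := 1536 * M + 1200 with hK
  have hK0 : 0 < K := by positivity
  refine ⟨min 1 (M / (6 * (1 + |σ|))), by positivity, ε / (2 * K), by positivity, ?_⟩
  intro ℓ hbar xmax hpos hle hmax h1
  obtain ⟨hL, hσ⟩ := angular_large hM hpos (hle.trans (min_le_right _ _)) h1
  have hr₀ := abs_sub_three_mul_le hM (radius_mem hM xmax) hL hσ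
    (derivNumerator_eq_zero_of_isMaxOn hM hmax)
  obtain ⟨hlam1, hlam2⟩ := coupling_bounds hM hσ hr₀ h1
  set v := semiPotential M σ ℓ hbar xmax with hv_def
  have hv : ContDiff ℝ ∞ v := semiPotential_contDiff hM σ ℓ hbar xmax
  have hv' := (contDiff_infty_iff_deriv.1 hv)
  have hf := escape_contDiff hM xmax
  have hf' := (contDiff_infty_iff_deriv.1 hf)
  obtain ⟨b₁, hb₁⟩ : ∃ b₁, ∀ x, |v x| ≤ b₁ := by
    refine ⟨hbar ^ 2 * (((ℓ : ℝ) * (ℓ + 1) + |σ|) / (4 * M ^ 2)), fun x => ?_⟩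
    rw [hv_def, semiPotential, abs_mul, abs_of_nonneg (sq_nonneg hbar)]
    exact mul_le_mul_of_nonneg_left (abs_potential_le hM σ ℓ _) (sq_nonneg _)
  obtain ⟨b₂, hb₂⟩ := exists_abs_mul_deriv_le hM σ ℓ hbar xmax
  refine ⟨isSelfAdjoint_realization_schrodinger hbar hv hb₁, fun ψ => ?_⟩
  have hform : ∀ φ : TestFn,
      (hbar : ℂ) * inner ℂ (toL2 φ) (toL2 (schrodinger hbar v hv φ)) ≤
        (K : ℂ) * inner ℂ (toL2 φ)
          (toL2 (scaledCommutator hbar (schrodinger hbar v hv) (dilation hbar) φ)) := by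
    refine form_le_form_commutator hpos hv hv'.2 (fun x => (hv'.1 x).hasDerivAt)
      (hle.trans (min_le_left _ _)) hf hf'.2 (fun x => (hf'.1 x).hasDerivAt)
      (κ := 12 * (hbar ^ 2 * ((ℓ : ℝ) * (ℓ + 1))) / M) (D := 1200) (by positivity) (by norm_num)
      ?_ (escape_sq_le hM hL hσ hmax hr₀ hlam1) (semiPotential_le hM hL hσ hmax hr₀)
    rw [hK]
    gcongr
    rw [div_le_iff₀ hM]
    linarith
  have hdom := mem_domain_commutator_of_mem_domain hpos.ne' hv hv'.2
    (fun x => (hv'.1 x).hasDerivAt) (b := 2 * b₁ + b₂) (fun x => by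
      refine (abs_add_le _ _).trans (add_le_add ?_ (hb₂ x))
      rw [abs_mul, abs_two]
      exact mul_le_mul_of_nonneg_left (hb₁ x) two_pos.le) hform
  have hE : ∃ E, IsSpectralMeasure (hamiltonian hM σ ℓ hbar xmax) E :=
    exists_isSpectralMeasure_realization_schrodinger hbar hv hb₁
  have hproj : energyProjection hM σ ℓ hbar xmax (Icc (ε / 2) 100) =
      hE.choose (Icc (ε / 2) 100) := dif_pos hE
  rw [hproj, hE.choose_spec.inner_apply measurableSet_Icc]
  obtain ⟨hmem, hlow⟩ := hE.choose_spec.range_apply_Icc (ε / 2) 100 ψ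
  obtain ⟨hmem', hle'⟩ := hdom _ hmem
  refine ⟨hmem', ?_⟩
  -- On the spectral range, `ħ ε/2 ≤ ħ H ≤ K (i/ħ)[H, A]` as forms; dividing by `K` gives the claim.
  have hlow' := (mul_le_mul_of_nonneg_left hlow
    (Complex.zero_le_real.2 hpos.le)).trans hle'
  have hfin := mul_le_mul_of_nonneg_left hlow' (Complex.zero_le_real.2 (inv_nonneg.2 hK0.le))
  have hKne : (K : ℂ) ≠ 0 := by exact_mod_cast hK0.ne'
  refine le_of_eq_of_le ?_ (le_of_le_of_eq hfin ?_)
  · push_cast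
    field_simp
  · rw [← mul_assoc, ← Complex.ofReal_mul, inv_mul_cancel₀ hK0.ne', Complex.ofReal_one, one_mul]
    rfl
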